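/- **Setting.** Fix sets $\mathbf H(m)$ ($m<\omega$) with at least two elements each, and an element of each $\mathbf H(m)$, written $0$. Sequences are elements of $\bigcup_n\prod_{i<n}\mathbf H(i)$; $u\trianglelefteq v$ means that $u$ is an initial segment of $v$ and $u\vartriangleleft v$ that it is a proper one; $\mathbf 0_{[a,b)}$ is the zero sequence on $[a,b)$. A *creature* is a triple $t=(\mathrm{nor}[t],\mathrm{val}[t],\mathrm{dis}[t])$ where $\mathrm{nor}[t]\in\mathbb R^{\ge 0}$, $\mathrm{dis}[t]$ is an arbitrary label, and $\mathrm{val}[t]\ne\emptyset$ is a set of pairs $\langle x,y\rangle$ of sequences such that $x\vartriangleleft y$, all the $x$ have one length $m^t_{\rm dn}$ and all the $y$ have one length $m^t_{\rm up}$. A *creating pair* $(K,\Sigma)$ consists of a set $K$ of creatures and an operation assigning to each finite sequence from $K$ a set $\Sigma(t_0,\dots,t_{n-1})\subseteq K$ such that: $\Sigma$ of the empty sequence is $\emptyset$; $t\in\Sigma(t)$; if $s_i\in\Sigma(\bar t_i)$ for $i<m$ then $\Sigma(s_0,\dots,s_{m-1})\subseteq\Sigma(\bar t_0{}^\frown\cdots{}^\frown\bar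 t_{m-1})$; if $\Sigma(t_0,\dots,t_{n-1})\neq\emptyset$ then $m^{t_i}_{\rm up}=m^{t_{i+1}}_{\rm dn}$ for $i<n-1$; and $m^s_{\rm dn}=m^{t_0}_{\rm dn}$, $m^s_{\rm up}=m^{t_{n-1}}_{\rm up}$ for $s\in\Sigma(t_0,\dots,t_{n-1})$. Let $\mathrm{basis}(t)=\{w:(\exists s\in\Sigma(t))(\exists u)\,\langle w,u\rangle\in\mathrm{val}[s]\}$, and let $\mathrm{pos}(w,t_0,\dots,t_{n-1})$ be the set of all $v$ for which there are $0=k_0<k_1<\dots<k_\ell=n$ and $w=v_0\vartriangleleft v_1\vartriangleleft\dots\vartriangleleft v_\ell=v$ with $\langle v_i,v_{i+1}\rangle\in\mathrm{val}[s]$ for some $s\in\Sigma(t_{k_i},\dots,t_{k_{i+1}-1})$, for all $i<\ell$; for the empty sequence it is $\{w\}$. $(w,t_0,\dots,t_{n-1})\in\mathrm{FC}$ ($n\ge 1$) means that $t_i\in K$, $m^{t_i}_{\rm up}=m^{t_{i+1}}_{\rm dn}$ and $\mathrm{pos}(w,t_0,\dots,t_{i-1})\subseteq\mathrm{basis}(t_i)$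 for all relevant $i$ (for $i=0$: $w\in\mathrm{basis}(t_0)$), and $(t_0,\dots,t_{n-1})\in\mathrm{PFC}$ means that this holds for some $w$. $\mathrm{PC}$ is defined like $\mathrm{PFC}$, for infinite sequences. For infinite sequences, $\bar t\le\bar s$ means that for some $0=k_0<k_1<\cdots$ we have $s_i\in\Sigma(t_{k_i},\dots,t_{k_{i+1}-1})$ for all $i$. For $t,t'\in K$, $t\sim_\Sigma t'$ means that $t,t'$ have the same $\mathrm{nor}$ and $\mathrm{val}$ and that replacing $t$ by $t'$ at a place of any sequence does not change the value of $\Sigma$ at it. All creating pairs below are assumed to be * *nice*: $\mathrm{basis}(t_0)\subseteq\mathrm{basis}(s)$ for $s\in\Sigma(t_0,\dots,t_{n-1})$; and * *smooth*: if $(w,t_0,\dots,t_{n-1})\in\mathrm{FC}$, $m<n$, $u\in\mathrm{pos}(w,t_0,\dots,t_{n-1})$ then $u{\restriction}m^{t_m}_{\rm dn}\in\mathrm{pos}(w,t_0,\dots,t_{m-1})$ and $u\in\mathrm{pos}(u{\restriction}m^{t_m}_{\rm dn},t_m,\dots,t_{n-1})$. *The forcing notions.* Conditions of $\mathbb Q^*_\emptyset(K,\Sigma)$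 are all $p=(w,t_0,t_1,\dots)$ (also written $(w^p,t^p_0,t^p_1,\dots)$) with $t_i\in K$, $m^{t_i}_{\rm up}=m^{t_{i+1}}_{\rm dn}$ and $\mathrm{pos}(w,t_0,\dots,t_{i-1})\subseteq\mathrm{basis}(t_i)$ for all $i<\omega$. $\mathbb Q^*_{{\rm s}\infty}(K,\Sigma)$ is the set of those conditions for which $\mathrm{nor}[t_i]>\max\{i,m^{t_i}_{\rm dn}\}$ for all $i$, ordered by: $p\le q$ ($q$ is stronger) iff for some $k_0<k_1<\cdots$ we have $w^q\in\mathrm{pos}(w^p,t^p_0,\dots,t^p_{k_0-1})$ and $t^q_i\in\Sigma(t^p_{k_i},\dots,t^p_{k_{i+1}-1})$ for all $i$. A forcing notion $\mathbb P$ is *almost $\omega^\omega$-bounding* if for every $\mathbb P$-name $\dot f$ for an element of $\omega^\omega$ and every $p\in\mathbb P$ there is $g\in\omega^\omega$ such that for every infinite $A\subseteq\omega$ there is $q\ge p$ with $q\Vdash(\exists^\infty n\in A)(\dot f(n)<g(n))$. *Properties of $(K,\Sigma)$.* * *Finitary*: all $\mathbf H(m)$ and all $\mathrm{val}[t]$,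 $t\in K$, are finite. *Strongly finitary*: moreover every $\Sigma(t_0,\dots,t_{n-1})$ is finite modulo $\sim_\Sigma$. * *Growing*: for each $(t_0,\dots,t_{n-1})\in\mathrm{PFC}$ there is $t\in\Sigma(t_0,\dots,t_{n-1})$ with $\mathrm{nor}[t]\ge\max_{i<n}\mathrm{nor}[t_i]$. * *Condensed*: if $(w,t_0,\dots,t_{n-1})\in\mathrm{FC}$, all $\mathrm{nor}[t_i]>0$, $t\in\Sigma(t_0,\dots,t_{n-1})$ and $\mathrm{nor}[t]>0$, then there are $k<n$, $s\in\Sigma(t_k)$ with $\mathrm{nor}[s]>0$ and $v\in\mathrm{pos}(w,t_0,\dots,t_{k-1})$ such that $(\forall u\in\mathrm{pos}(v,s))(\exists u^*\in\mathrm{pos}(w,t))(u\trianglelefteq u^*)$. * *AB-type*: the following two conditions hold. 1. If $(t_0,\dots,t_{n-1})\in\mathrm{PFC}$ and $k<n$, then there is $t\in\Sigma(t_0,\dots,t_{n-1})$ with $\mathrm{nor}[t]\ge\min_{\ell<n}\mathrm{nor}[t_\ell]$ such that whenever $(w,t_0,\dots,t_{n-1})\in\mathrm{FC}$, $t'\in\Sigma(t)$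 and $\mathrm{nor}[t']>0$, there is $t''\in\Sigma(t_k)$ with $\mathrm{nor}[t'']>0$ and $(\exists u'\in\mathrm{pos}(w,t_0,\dots,t_{k-1}))(\forall u''\in\mathrm{pos}(u',t''))(\exists v\in\mathrm{pos}(w,t'))(u''\trianglelefteq v)$. 2. Let $p\in\mathbb Q^*_\emptyset(K,\Sigma)$, $N_0<\omega$, $\mathrm{nor}[t^p_i]>2$ for $i\ge N_0$, and let $z$ be a *decision function*, i.e. $z:\mathrm{pos}(w^p,t^p_0,\dots,t^p_{N_0-1})\times\mathrm{PC}\to\bigcup_{k\ge N_0}\mathrm{pos}(w^p,t^p_0,\dots,t^p_{k-1})$ and for all $v$ in its first domain and all $\bar t'\in\mathrm{PC}$ with $\langle t^p_{N_0},t^p_{N_0+1},\dots\rangle\le\bar t'$ there is $k$ with $z(v,\bar t')\in\mathrm{pos}(v,t'_0,\dots,t'_{k-1})$ such that $z(v,\bar t'')=z(v,\bar t')$ whenever $\langle t^p_{N_0},\dots\rangle\le\bar t''\in\mathrm{PC}$ and $t''_i\sim_\Sigma t'_i$ for $i<k$. Then there are $N_1>N_0$ and $t^*\in\Sigma(t^p_{N_0},\dots,t^p_{N_1-1})$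 with $\mathrm{nor}[t^*]\ge\frac12\min\{\mathrm{nor}[t^p_i]:N_0\le i<N_1\}$ such that for each $v\in\mathrm{pos}(w^p,t^p_0,\dots,t^p_{N_0-1})$ and $t\in\Sigma(t^*)$ with $\mathrm{nor}[t]>0$ there is $\bar t'\in\mathrm{PC}$ with $\langle t^p_{N_0},\dots\rangle\le\bar t'$ such that ($\alpha$) if $t'_i\in\Sigma(t^p_{N_0+k},\dots,t^p_{N_0+k+\ell})$ then $\mathrm{nor}[t'_i]\ge\frac12\min\{\mathrm{nor}[t^p_{N_0+k}],\dots,\mathrm{nor}[t^p_{N_0+k+\ell}]\}$, and ($\beta$) $(\exists w\in\mathrm{pos}(v,t))(z(v,\bar t')\trianglelefteq w)$. * For $m_0\le m^t_{\rm dn}$, $m^t_{\rm up}\le m_1$ let $s=t\Rsh[m_0,m_1)$ be given by $\mathrm{nor}[s]=\mathrm{nor}[t]$, $\mathrm{val}[s]=\{\langle w,u\rangle: \mathrm{lh}(w)=m_0,\ \mathrm{lh}(u)=m_1,\ w\vartriangleleft u,\ \langle u{\restriction}m^t_{\rm dn},u{\restriction}m^t_{\rm up}\rangle\in\mathrm{val}[t],\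 u(i)=0\text{ for }i\in[m_0,m^t_{\rm dn})\cup[m^t_{\rm up},m_1)\}$, and $\mathrm{dis}[s]=e(m_0,m_1,\mathrm{dis}[t])$, where $e$ is any fixed rule (e.g. $e(m_0,m_1,x)=\langle 4,m_0,m_1,x\rangle$). $(K,\Sigma)$ is *omittory* if (0) for $t\in K$, $u\in\mathrm{basis}(t)$ we have $u{}^\frown\mathbf 0_{[m^t_{\rm dn},m^t_{\rm up})}\in\mathrm{pos}(u,t)$ and some $v\in\mathrm{pos}(u,t)$ is not zero on $[m^t_{\rm dn},m^t_{\rm up})$; (1) $t_i\Rsh[m^{t_0}_{\rm dn},m^{t_{n-1}}_{\rm up})\in\Sigma(t_0,\dots,t_{n-1})$ for all $(t_0,\dots,t_{n-1})\in\mathrm{PFC}$, $i<n$; (2) if $t,\,t\Rsh[m_0,m_1)\in K$, $u\in\mathrm{basis}(t\Rsh[m_0,m_1))$, $v\in\mathrm{pos}(u,t\Rsh[m_0,m_1))$, $\mathrm{lh}(u)\le n<\mathrm{lh}(v)$ and $v(n)\ne 0$, then $n\in[m^t_{\rm dn},m^t_{\rm up})$. * *Weak Halving Property*: there is a map $\mathrm{half}:K\to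 K$ (which is then fixed) such that $\mathrm{half}(t)\in\Sigma(t)$, $\mathrm{nor}[\mathrm{half}(t)]\ge\frac12\mathrm{nor}[t]$ for $t\in K$, and if $\mathrm{nor}[t_0]\ge2$, $t\in\Sigma(\mathrm{half}(t_0))$, $\mathrm{nor}[t]>0$, then there is $s\in\Sigma(t_0)$ with $\mathrm{nor}[s]\ge\frac12\mathrm{nor}[t_0]$ and $\mathrm{pos}(u,s)\subseteq\mathrm{pos}(u,t)$ for all $u\in\mathrm{basis}(t_0)$. * A *nice pre-norm with values in $\omega$* is a monotone $N:\mathcal P(\omega)\to\omega$ with $N(\omega)>0$, $N(\{a\})\le1$ for $a\in\omega$, such that if $B\subseteq C$ and $N(C)>1$ then $N(B)\ge N(C)-1$ or $N(C\setminus B)\ge N(C)-1$. For creatures $t_i$ ($m_0\le i<m_1$) with $m^{t_i}_{\rm up}\le m^{t_{i+1}}_{\rm dn}$ and a nonempty $u\subseteq[m_0,m_1)$ let $S_{N,u}(t_i:m_0\le i<m_1)$ have norm $\min(\{N(u)\}\cup\{\mathrm{nor}[t_i]:i\in u\})$, value the set of all $\langle h_1,h_2\rangle$ with $\mathrm{lh}(h_1)=m^{t_{m_0}}_{\rm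 dn}$, $\mathrm{lh}(h_2)=m^{t_{m_1-1}}_{\rm up}$, $h_1\vartriangleleft h_2$, $\langle h_2{\restriction}m^{t_i}_{\rm dn},h_2{\restriction}m^{t_i}_{\rm up}\rangle\in\mathrm{val}[t_i]$ for $i\in u$ and $h_2$ zero on $[m^{t_i}_{\rm dn},m^{t_i}_{\rm up})$ for $i\notin u$ and on all $[m^{t_i}_{\rm up},m^{t_{i+1}}_{\rm dn})$, and a label given by any fixed rule from $N$, $u$, $m_0$ and $\langle\mathrm{dis}[t_i]:m_0\le i<m_1\rangle$. $(K,\Sigma)$ is *saturated* with respect to such pre-norms if for each such $N$, each $(t_i:m_0\le i<m_1)\in\mathrm{PFC}$ and each nonempty $u\subseteq[m_0,m_1)$ with $N(u)>0$ and $\mathrm{nor}[t_i]>0$ for $i\in u$: $S=S_{N,u}(t_i:m_0\le i<m_1)\in\Sigma(t_i:m_0\le i<m_1)$, and for each $t\in\Sigma(S)$ with $\mathrm{nor}[t]>0$ there are a nonempty $u^*\subseteq u$ with $N(u^*)>0$ and $s_i\in\Sigma(t_i)$ ($m_0\le i<m_1$) such that $\mathrm{nor}[s_i]>0$ for $i\in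 u^*$ and $\mathrm{val}[S_{N,u^*}(s_i:m_0\le i<m_1)]\subseteq\mathrm{val}[t]$. **Theorem.** Let $(K,\Sigma)$ be a (nice and smooth) creating pair. 1. If $(K,\Sigma)$ is finitary, growing, condensed and of the AB-type, then $\mathbb Q^*_{{\rm s}\infty}(K,\Sigma)$ is almost $\omega^\omega$-bounding. 2. Suppose that $(K,\Sigma)$ is strongly finitary and omittory, has the weak Halving Property, is saturated with respect to nice pre-norms with values in $\omega$, and that for each $t\in K$: * $(\otimes_1)$ $\mathrm{val}[s]\subseteq\mathrm{val}[t]$ for all $s\in\Sigma(t)$; * $(\otimes_2)$ if $m_0\le m^t_{\rm dn}$, $m^t_{\rm up}\le m_1$, $t\Rsh[m_0,m_1)\in K$ and $s\in\Sigma(\mathrm{half}(t))$, then $s\Rsh[m_0,m_1)\in\Sigma(\mathrm{half}(t\Rsh[m_0,m_1)))$; * $(\oplus_3)$ if $m_0\le m^t_{\rm dn}$, $m^t_{\rm up}\le m_1$ and $t\Rsh[m_0,m_1)\in K$, then $\Sigma(t\Rsh[m_0,m_1))=\{s\Rsh[m_0,m_1):s\in\Sigma(t)\}$ modulo $\sim_\Sigma$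 (each element of either set is $\sim_\Sigma$-equivalent to an element of the other). Then $(K,\Sigma)$ is of the AB-type. Consequently, if $(K,\Sigma)$ is moreover condensed, then $\mathbb Q^*_{{\rm s}\infty}(K,\Sigma)$ is almost $\omega^\omega$-bounding. -/

import Mathlib

open scoped NNReal

namespace Creatures

universe u v

/-! ## Finite sequences -/

/-- The function `𝐇`: a sequence of sets `𝐇(m)`, `m < ω`, each with at least two elements, and with a
fixed element of each, which is written `0`. -/
structure Alphabet (A : Type u) where
  carrier : ℕ → Set A
  zero : ℕ → A
  zero_mem : ∀ m, zero m ∈ carrier m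
  two_le : ∀ m, (carrier m).Nontrivial

variable {A : Type u} {D : Type v}

/-- `w ∈ ∏_{i < lh(w)} 𝐇(i)`. -/
def Alphabet.IsSeq (H : Alphabet A) (w : List A) : Prop :=
  ∀ i a, w[i]? = some a → a ∈ H.carrier i

/-- The sequence `0_{[a,b)}`. -/
def Alphabet.zeros (H : Alphabet A) (a b : ℕ) : List A :=
  (List.range' a (b - a)).map H.zero

/-- `w` is identically zero on `[a,b)`. -/
def Alphabet.ZeroOn (H : Alphabet A) (w : List A) (a b : ℕ) : Prop :=
  ∀ i, a ≤ i → i < b → w[i]? = some (H.zero i)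

/-- The list `[t a, t (a+1), …, t (b-1)]`. -/
def seg {X : Type*} (t : ℕ → X) (a b : ℕ) : List X :=
  (List.range' a (b - a)).map t

/-! ## Weak creatures and creatures -/

/-- The data `(nor, val, dis)` of a weak creature.  `D` is the type of the distinguishing labels. -/
structure WeakCreature (A : Type u) (D : Type v) where
  nor : ℝ≥0
  val : Set (List A × List A)
  dis : D

/-- `t` is a weak creature for `𝐇`. -/
def IsWeakCreature (H : Alphabet A) (t : WeakCreature A D) : Prop :=
  t.val.Nonempty ∧
    ∀ x y, (x, y) ∈ t.val → H.IsSeq x ∧ H.IsSeq y ∧ x <+: y ∧ x ≠ y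

namespace WeakCreature

/-- `m_dn`: the least length of an element of the domain of `val`. -/
noncomputable def mdn (t : WeakCreature A D) : ℕ :=
  sInf {n | ∃ x ∈ t.val, x.1.length = n}

/-- `m_up`: the least length of an element of the range of `val`. -/
noncomputable def mup (t : WeakCreature A D) : ℕ :=
  sInf {n | ∃ x ∈ t.val, x.2.length = n}

/-- The creature `t ⇛ [m₀, m₁)`, where `e` is the rule that produces its label from
`m₀`, `m₁` and the label of `t`. -/
noncomputable def extend (H : Alphabet A) (e : ℕ → ℕ → D → D) (t : WeakCreature A D)
    (m₀ m₁ : ℕ) : WeakCreature A D where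
  nor := t.nor
  val := {x | H.IsSeq x.1 ∧ H.IsSeq x.2 ∧ x.1.length = m₀ ∧ x.2.length = m₁ ∧
    x.1 <+: x.2 ∧ x.1 ≠ x.2 ∧ (x.2.take t.mdn, x.2.take t.mup) ∈ t.val ∧
    H.ZeroOn x.2 m₀ t.mdn ∧ H.ZeroOn x.2 t.mup m₁}
  dis := e m₀ m₁ t.dis

end WeakCreature

/-- `t` is a creature for `𝐇`: the lengths of both components of the elements of `val[t]` are
constant. -/
def IsCreature (H : Alphabet A) (t : WeakCreature A D) : Prop :=
  IsWeakCreature H t ∧ ∀ x ∈ t.val, x.1.length = t.mdn ∧ x.2.length = t.mup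

/-- `min {nor[t_i] : a ≤ i < b}` (for `a < b`). -/
noncomputable def minNor (t : ℕ → WeakCreature A D) (a b : ℕ) : ℝ≥0 :=
  sInf ((fun i => (t i).nor) '' Set.Ico a b)

/-! ## Creating pairs -/

/-- A creating pair `(K, Σ)` for `𝐇`.  A set of creatures on which a composition operation can be
nonempty can be listed as `t_0, …, t_{m-1}` with `m_up(t_i) = m_dn(t_{i+1})` in exactly one way,
and it is identified with this list; `Σ` is empty at all other lists. -/
structure CreatingPair (H : Alphabet A) (D : Type v) where
  K : Set (WeakCreature A D)
  Sig : List (WeakCreature A D) → Set (WeakCreature A D)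
  isCreature : ∀ t ∈ K, IsCreature H t
  sig_subset : ∀ l, Sig l ⊆ K
  mem_of_sig : ∀ l, (Sig l).Nonempty → ∀ t ∈ l, t ∈ K
  sig_nil : Sig [] = ∅
  sig_self : ∀ t ∈ K, t ∈ Sig [t]
  sig_trans : ∀ (l : List (WeakCreature A D)) (L : List (List (WeakCreature A D))),
    List.Forall₂ (fun s S => s ∈ Sig S) l L → Sig l ⊆ Sig L.flatten
  sig_chain : ∀ l, (Sig l).Nonempty → l.IsChain (fun s t => s.mup = t.mdn)
  sig_mdn : ∀ (l : List (WeakCreature A D)) (hl : l ≠ []), ∀ s ∈ Sig l, s.mdn = (l.head hl).mdn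
  sig_mup : ∀ (l : List (WeakCreature A D)) (hl : l ≠ []), ∀ s ∈ Sig l, s.mup = (l.getLast hl).mup

namespace CreatingPair

variable {H : Alphabet A} (P : CreatingPair H D)

/-- `t₀ ∼_Σ t₁`. -/
def Equivalent (t₀ t₁ : WeakCreature A D) : Prop :=
  t₀ ∈ P.K ∧ t₁ ∈ P.K ∧ t₀.nor = t₁.nor ∧ t₀.val = t₁.val ∧
    ∀ l l' : List (WeakCreature A D), P.Sig (l ++ t₀ :: l') = P.Sig (l ++ t₁ :: l')

/-- `basis(t)`. -/
def basis (t : WeakCreature A D) : Set (List A) :=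
  {w | ∃ s ∈ P.Sig [t], ∃ u, (w, u) ∈ s.val}

/-- `v ∈ pos(w, t_0, …, t_{n-1})`: one can go from `w` to `v` in finitely many steps, the sequence
`t_0, …, t_{n-1}` being cut into consecutive pieces, and each step using an element of `Σ` of the
respective piece.  In particular `pos(w) = {w}` for the empty sequence. -/
inductive Pos (w : List A) : List (WeakCreature A D) → List A → Prop
  | nil : Pos w [] w
  | step {l l' : List (WeakCreature A D)} {u v : List A} {s : WeakCreature A D} :
      Pos w l u → s ∈ P.Sig l' → (u, v) ∈ s.val → Pos w (l ++ l') v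

/-- `pos(w, t_0, …, t_{n-1})`. -/
def pos (w : List A) (l : List (WeakCreature A D)) : Set (List A) := {v | P.Pos w l v}

/-- `(w, t_a, …, t_{b-1}) ∈ FC(K, Σ)`. -/
def FC (w : List A) (t : ℕ → WeakCreature A D) (a b : ℕ) : Prop :=
  a < b ∧ (∀ i, a ≤ i → i < b → t i ∈ P.K ∧ P.pos w (seg t a i) ⊆ P.basis (t i)) ∧
    ∀ i, a ≤ i → i + 1 < b → (t i).mup = (t (i + 1)).mdn

/-- `(t_a, …, t_{b-1}) ∈ PFC(K, Σ)`. -/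
def PFC (t : ℕ → WeakCreature A D) (a b : ℕ) : Prop := ∃ w, P.FC w t a b

/-- `t_i ∈ K`, `m_up(t_i) = m_dn(t_{i+1})`, `w ∈ basis(t_0)` and
`pos(w, t_0, …, t_i) ⊆ basis(t_{i+1})` for all `i < ω`. -/
def Candidate (w : List A) (t : ℕ → WeakCreature A D) : Prop :=
  ∀ i, t i ∈ P.K ∧ (t i).mup = (t (i + 1)).mdn ∧ P.pos w (seg t 0 i) ⊆ P.basis (t i)

/-- `⟨t_0, t_1, …⟩ ∈ PC(K, Σ)`. -/
def PC (t : ℕ → WeakCreature A D) : Prop := ∃ w, P.Candidate w t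

/-- The order `⟨t_0, t_1, …⟩ ≤ ⟨s_0, s_1, …⟩` of pure candidates. -/
def PCLe (t s : ℕ → WeakCreature A D) : Prop :=
  ∃ k : ℕ → ℕ, StrictMono k ∧ k 0 = 0 ∧ ∀ i, s i ∈ P.Sig (seg t (k i) (k (i + 1)))

/-- `(K, Σ)` is nice. -/
def Nice : Prop :=
  ∀ (t : WeakCreature A D) (l : List (WeakCreature A D)), ∀ s ∈ P.Sig (t :: l),
    P.basis t ⊆ P.basis s

/-- `(K, Σ)` is smooth. -/
def Smooth : Prop :=
  ∀ w t a b, P.FC w t a b → ∀ m, a ≤ m → m < b → ∀ u ∈ P.pos w (seg t a b),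
    u.take (t m).mdn ∈ P.pos w (seg t a m) ∧ u ∈ P.pos (u.take (t m).mdn) (seg t m b)

/-- `(K, Σ)` is finitary. -/
def Finitary : Prop :=
  (∀ m, (H.carrier m).Finite) ∧ ∀ t ∈ P.K, t.val.Finite

/-- `(K, Σ)` is strongly finitary: it is finitary and every `Σ(t_0, …, t_{n-1})` is finite
modulo `∼_Σ`. -/
def StronglyFinitary : Prop :=
  P.Finitary ∧ ∀ l, ∃ F : Set (WeakCreature A D), F.Finite ∧ F ⊆ P.Sig l ∧
    ∀ s ∈ P.Sig l, ∃ r ∈ F, P.Equivalent s r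

/-- `(K, Σ)` is growing. -/
def Growing : Prop :=
  ∀ t a b, P.PFC t a b →
    ∃ s ∈ P.Sig (seg t a b), ∀ i, a ≤ i → i < b → (t i).nor ≤ s.nor

/-- `(K, Σ)` is condensed. -/
def Condensed : Prop :=
  ∀ w t a b, P.FC w t a b → (∀ i, a ≤ i → i < b → 0 < (t i).nor) →
    ∀ r ∈ P.Sig (seg t a b), 0 < r.nor →
      ∃ k, a ≤ k ∧ k < b ∧ ∃ s ∈ P.Sig [t k], ∃ v ∈ P.pos w (seg t a k),
        0 < s.nor ∧ ∀ u ∈ P.pos v [s], ∃ u' ∈ P.pos w [r], u <+: u'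

/-- `(K, Σ)` is omittory; the labels of the creatures `t ⇛ [m₀, m₁)` are given by the rule `e`. -/
structure Omittory (e : ℕ → ℕ → D → D) : Prop where
  zero_pos : ∀ t ∈ P.K, ∀ u ∈ P.basis t, u ++ H.zeros t.mdn t.mup ∈ P.pos u [t] ∧
    ∃ v ∈ P.pos u [t], v.drop t.mdn ≠ H.zeros t.mdn t.mup
  extend_mem : ∀ t a b, P.PFC t a b → ∀ i, a ≤ i → i < b →
    (t i).extend H e (t a).mdn (t (b - 1)).mup ∈ P.Sig (seg t a b)
  pos_extend : ∀ t ∈ P.K, ∀ m₀ m₁, m₀ ≤ t.mdn → t.mup ≤ m₁ → t.extend H e m₀ m₁ ∈ P.K →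
    ∀ u ∈ P.basis (t.extend H e m₀ m₁), ∀ v ∈ P.pos u [t.extend H e m₀ m₁],
      ∀ n, u.length ≤ n → n < v.length → v[n]? ≠ some (H.zero n) → t.mdn ≤ n ∧ n < t.mup

/-- `half` witnesses the weak Halving Property of `(K, Σ)`. -/
def WeakHalving (half : WeakCreature A D → WeakCreature A D) : Prop :=
  (∀ t ∈ P.K, half t ∈ P.Sig [t] ∧ t.nor / 2 ≤ (half t).nor) ∧
    ∀ t₀ ∈ P.K, 2 ≤ t₀.nor → ∀ t ∈ P.Sig [half t₀], 0 < t.nor →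
      ∃ s ∈ P.Sig [t₀], t₀.nor / 2 ≤ s.nor ∧
        ∀ u ∈ P.basis t₀, P.pos u [s] ⊆ P.pos u [t]

end CreatingPair

/-! ## Pre-norms and saturation -/

/-- `N` is a nice pre-norm on (the power set of) `X`. -/
structure IsNicePreNorm {X : Type*} (N : Set X → ℝ≥0) : Prop where
  mono : ∀ B C : Set X, B ⊆ C → N B ≤ N C
  univ_pos : 0 < N Set.univ
  singleton_le : ∀ a, N {a} ≤ 1
  split : ∀ B C : Set X, B ⊆ C → 1 < N C → N C - 1 ≤ N B ∨ N C - 1 ≤ N (C \ B)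

/-- The set `val` of the `(d,u)`-sum of the creatures `t_i`, `a ≤ i < b`.  It does not depend
on `d`. -/
def sumVal (H : Alphabet A) (u : Finset ℕ) (t : ℕ → WeakCreature A D) (a b : ℕ) :
    Set (List A × List A) :=
  {x | H.IsSeq x.1 ∧ H.IsSeq x.2 ∧ x.1.length = (t a).mdn ∧ x.2.length = (t (b - 1)).mup ∧
    x.1 <+: x.2 ∧ x.1 ≠ x.2 ∧
    (∀ i, a ≤ i → i < b → i ∈ u → (x.2.take (t i).mdn, x.2.take (t i).mup) ∈ (t i).val) ∧
    (∀ i, a ≤ i → i < b → i ∉ u → H.ZeroOn x.2 (t i).mdn (t i).mup) ∧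
    ∀ i, a ≤ i → i + 1 < b → H.ZeroOn x.2 (t i).mup (t (i + 1)).mdn}

/-- The `(d,u)`-sum of the creatures `t_i`, `a ≤ i < b`, where
`d(⟨r_i : i ∈ u⟩) = min {N(u), r_i : i ∈ u}` for the nonempty set `u`.  Its label is given
by the rule `c` from `N`, `u` and the labels of the `t_i`. -/
noncomputable def dSum (H : Alphabet A) (c : (Set ℕ → ℝ≥0) → Finset ℕ → ℕ → List D → D)
    (N : Set ℕ → ℝ≥0) (u : Finset ℕ) (t : ℕ → WeakCreature A D) (a b : ℕ) :
    WeakCreature A D where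
  nor := min (N u) (sInf ((fun i => (t i).nor) '' (u : Set ℕ)))
  val := sumVal H u t a b
  dis := c N u a ((seg t a b).map WeakCreature.dis)

namespace CreatingPair

variable {H : Alphabet A} (P : CreatingPair H D)

/-- `(K, Σ)` is saturated with respect to the pre-norm `N` on `ω`; the labels of the sums are given
by the rule `c`.  The elements `d` of `D_N` correspond to the finite nonempty sets `u` with
`N(u) > 0`. -/
def Saturated (c : (Set ℕ → ℝ≥0) → Finset ℕ → ℕ → List D → D) (N : Set ℕ → ℝ≥0) : Prop :=
  ∀ u : Finset ℕ, u.Nonempty → 0 < N u → ∀ t a b, P.PFC t a b → u ⊆ Finset.Ico a b →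
    (∀ i ∈ u, 0 < (t i).nor) →
      dSum H c N u t a b ∈ P.Sig (seg t a b) ∧
      ∀ r ∈ P.Sig [dSum H c N u t a b], 0 < r.nor →
        ∃ (u' : Finset ℕ) (s : ℕ → WeakCreature A D), u'.Nonempty ∧ 0 < N u' ∧ u' ⊆ u ∧
          (∀ i, a ≤ i → i < b → s i ∈ P.Sig [t i]) ∧
          sumVal H u' s a b ⊆ r.val ∧ ∀ i ∈ u', 0 < (s i).nor

/-- `(K, Σ)` is saturated with respect to nice pre-norms with values in `ω`. -/
def SaturatedNiceNat (c : (Set ℕ → ℝ≥0) → Finset ℕ → ℕ → List D → D) : Prop :=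
  ∀ N : Set ℕ → ℝ≥0, IsNicePreNorm N → (∀ u, ∃ n : ℕ, N u = n) → P.Saturated c N

/-- `(⊗₁)`: `val[s] ⊆ val[t]` whenever `s ∈ Σ(t)`. -/
def ValMonotone : Prop := ∀ t ∈ P.K, ∀ s ∈ P.Sig [t], s.val ⊆ t.val

/-- `(⊗₂)`: `s ⇛ [m₀, m₁) ∈ Σ(half(t ⇛ [m₀, m₁)))` whenever `s ∈ Σ(half(t))`. -/
def HalfExtend (e : ℕ → ℕ → D → D) (half : WeakCreature A D → WeakCreature A D) : Prop :=
  ∀ t ∈ P.K, ∀ m₀ m₁, m₀ ≤ t.mdn → t.mup ≤ m₁ → t.extend H e m₀ m₁ ∈ P.K →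
    ∀ s ∈ P.Sig [half t], s.extend H e m₀ m₁ ∈ P.Sig [half (t.extend H e m₀ m₁)]

/-- `(⊕₃)`: `Σ(t ⇛ [m₀, m₁)) = {s ⇛ [m₀, m₁) : s ∈ Σ(t)}` modulo `∼_Σ`. -/
def SigExtend (e : ℕ → ℕ → D → D) : Prop :=
  ∀ t ∈ P.K, ∀ m₀ m₁, m₀ ≤ t.mdn → t.mup ≤ m₁ → t.extend H e m₀ m₁ ∈ P.K →
    (∀ r ∈ P.Sig [t.extend H e m₀ m₁], ∃ s ∈ P.Sig [t], P.Equivalent r (s.extend H e m₀ m₁)) ∧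
    ∀ s ∈ P.Sig [t], ∃ r ∈ P.Sig [t.extend H e m₀ m₁], P.Equivalent r (s.extend H e m₀ m₁)

/-! ## The AB-type -/

/-- `z` is a decision function for `p = (w, t_0, t_1, …)`, `N₀` and `(K, Σ)`.  Only the values of `z`
at pairs from `pos(w, t_0, …, t_{N₀-1}) × PC(K, Σ)` matter. -/
def IsDecisionFunction (w : List A) (t : ℕ → WeakCreature A D) (N₀ : ℕ)
    (z : List A → (ℕ → WeakCreature A D) → List A) : Prop :=
  (∀ v ∈ P.pos w (seg t 0 N₀), ∀ t', P.PC t' →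
    ∃ k, N₀ ≤ k ∧ z v t' ∈ P.pos w (seg t 0 k)) ∧
  ∀ v ∈ P.pos w (seg t 0 N₀), ∀ t', P.PC t' → P.PCLe (fun i => t (N₀ + i)) t' →
    ∃ k, z v t' ∈ P.pos v (seg t' 0 k) ∧
      ∀ t'', P.PC t'' → P.PCLe (fun i => t (N₀ + i)) t'' →
        (∀ i, i < k → P.Equivalent (t'' i) (t' i)) → z v t'' = z v t'

/-- The first condition in the definition of the AB-type. -/
def ABZero : Prop :=
  ∀ t a b, P.PFC t a b → ∀ k, a ≤ k → k < b →
    ∃ s ∈ P.Sig (seg t a b), minNor t a b ≤ s.nor ∧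
      ∀ w, P.FC w t a b → ∀ t' ∈ P.Sig [s], 0 < t'.nor →
        ∃ t'' ∈ P.Sig [t k], 0 < t''.nor ∧
          ∃ u' ∈ P.pos w (seg t a k), ∀ u'' ∈ P.pos u' [t''], ∃ v ∈ P.pos w [t'], u'' <+: v

/-- The second condition in the definition of the AB-type. -/
def ABOne : Prop :=
  ∀ w t, P.Candidate w t → ∀ N₀, (∀ i, N₀ ≤ i → 2 < (t i).nor) →
    ∀ z, P.IsDecisionFunction w t N₀ z →
      ∃ N₁, N₀ < N₁ ∧ ∃ s ∈ P.Sig (seg t N₀ N₁), minNor t N₀ N₁ / 2 ≤ s.nor ∧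
        ∀ v ∈ P.pos w (seg t 0 N₀), ∀ r ∈ P.Sig [s], 0 < r.nor →
          ∃ t', P.PC t' ∧ P.PCLe (fun i => t (N₀ + i)) t' ∧
            (∀ i k l, t' i ∈ P.Sig (seg t (N₀ + k) (N₀ + k + l + 1)) →
              minNor t (N₀ + k) (N₀ + k + l + 1) / 2 ≤ (t' i).nor) ∧
            ∃ v' ∈ P.pos v [r], z v t' <+: v'

/-- `(K, Σ)` is of the AB-type. -/
def ABType : Prop := P.ABZero ∧ P.ABOne

/-! ## The forcing notion -/

/-- The conditions `(w, t_0, t_1, …)` of `Q*_{s∞}(K, Σ)`. -/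
structure QStarSInf where
  w : List A
  t : ℕ → WeakCreature A D
  candidate : P.Candidate w t
  norm : ∀ i : ℕ, (max i (t i).mdn : ℕ) < (t i).nor

theorem Pos.trans {P : CreatingPair H D} {w u v : List A} {l l' : List (WeakCreature A D)}
    (h : P.Pos w l u) (h' : P.Pos u l' v) : P.Pos w (l ++ l') v := by
  induction h' with
  | nil => simpa using h
  | step _ hs hv ih => rw [← List.append_assoc]; exact Pos.step ih hs hv

theorem Pos.refine {P : CreatingPair H D} {w v : List A} {l : List (WeakCreature A D)}
    (h : P.Pos w l v) : ∀ L : List (List (WeakCreature A D)),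
    List.Forall₂ (fun s S => s ∈ P.Sig S) l L → P.Pos w L.flatten v := by
  induction h with
  | nil => intro L hL; cases hL; exact Pos.nil
  | @step l l' u v s _ hs hv ih =>
    intro L hL
    have h1 := List.forall₂_take_append L l l' hL.flip
    have h2 := List.forall₂_drop_append L l l' hL.flip
    have := Pos.step (ih _ h1.flip) (P.sig_trans _ _ h2.flip hs) hv
    rwa [← List.flatten_append, List.take_append_drop] at this

theorem seg_append {X : Type*} (t : ℕ → X) {a b c : ℕ} (hab : a ≤ b) (hbc : b ≤ c) :
    seg t a b ++ seg t b c = seg t a c := by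
  have h := List.range'_append (s := a) (m := b - a) (n := c - b) (step := 1)
  have e1 : a + 1 * (b - a) = b := by omega
  have e2 : b - a + (c - b) = c - a := by omega
  rw [e1, e2] at h
  simp only [seg, ← List.map_append, h]

theorem seg_flatten {X : Type*} (t : ℕ → X) {k : ℕ → ℕ} (hk : StrictMono k) {a b : ℕ}
    (hab : a ≤ b) :
    (seg (fun i => seg t (k i) (k (i + 1))) a b).flatten = seg t (k a) (k b) := by
  induction b, hab using Nat.le_induction with
  | base => simp [seg]
  | succ b hab ih =>
    rw [← seg_append _ hab (Nat.le_succ b), List.flatten_append, ih]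
    have : seg (fun i => seg t (k i) (k (i + 1))) b (b + 1) = [seg t (k b) (k (b + 1))] := by
      simp [seg]
    rw [this]
    simpa using seg_append t (hk.monotone hab) (hk.monotone (Nat.le_succ b))

theorem forall₂_seg {X Y : Type*} {R : X → Y → Prop} {s : ℕ → X} {S : ℕ → Y}
    (h : ∀ i, R (s i) (S i)) (a b : ℕ) : List.Forall₂ R (seg s a b) (seg S a b) := by
  simp only [seg, List.forall₂_map_left_iff, List.forall₂_map_right_iff]
  exact List.forall₂_same.2 fun i _ => h i

/-- The order of `Q*_{s∞}(K, Σ)`; a stronger condition is larger. -/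
instance : Preorder P.QStarSInf where
  le p q := ∃ k : ℕ → ℕ, StrictMono k ∧ q.w ∈ P.pos p.w (seg p.t 0 (k 0)) ∧
    ∀ i, q.t i ∈ P.Sig (seg p.t (k i) (k (i + 1)))
  le_refl p := ⟨id, strictMono_id, by simpa [seg, pos] using Pos.nil, fun i => by
    simpa [seg] using P.sig_self _ (p.candidate i).1⟩
  le_trans p q r := by
    rintro ⟨k, hk, hw, ht⟩ ⟨j, hj, hw', ht'⟩
    have key : ∀ a b, List.Forall₂ (fun s S => s ∈ P.Sig S) (seg q.t a b)
        (seg (fun i => seg p.t (k i) (k (i + 1))) a b) := forall₂_seg ht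
    refine ⟨k ∘ j, hk.comp hj, ?_, fun i => ?_⟩
    · have h1 := Pos.trans hw (Pos.refine hw' _ (key 0 (j 0)))
      rw [seg_flatten p.t hk (Nat.zero_le _),
        seg_append p.t (Nat.zero_le _) (hk.monotone (Nat.zero_le _))] at h1
      exact h1
    · have h2 := P.sig_trans _ _ (key (j i) (j (i + 1))) (ht' i)
      rw [seg_flatten p.t hk (hj.monotone (Nat.le_succ i))] at h2
      exact h2

end CreatingPair

/-! ## Almost bounding forcing notions -/

/-- A name for an element of the Baire space: a set of triples `(n, k, p)`, where `(n, k, p)` puts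
the pair `(n, k)` into (the graph of) the function if `p` is in the generic filter, and such
that every condition forces the result to be a function from `ω` to `ω`. -/
structure BaireName (Q : Type*) [Preorder Q] where
  mem : ℕ → ℕ → Q → Prop
  total : ∀ n p, ∃ q, p ≤ q ∧ ∃ k r, mem n k r ∧ r ≤ q
  functional : ∀ n k k' p p', mem n k p → mem n k' p' → (∃ q, p ≤ q ∧ p' ≤ q) → k = k'

/-- `q ⊩ (∃^∞ n ∈ B)(τ(n) < g(n))`: for every `m` the conditions which put into `τ` a pair `(n, k)`
with `n ∈ B`, `n > m` and `k < g(n)` are dense above `q`. -/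
def BaireName.ForcesInfOften {Q : Type*} [Preorder Q] (τ : BaireName Q) (q : Q) (B : Set ℕ)
    (g : ℕ → ℕ) : Prop :=
  ∀ m : ℕ, ∀ q', q ≤ q' → ∃ q'', q' ≤ q'' ∧
    ∃ n ∈ B, m < n ∧ ∃ k < g n, ∃ r, τ.mem n k r ∧ r ≤ q''

/-- The forcing notion `Q` (where stronger conditions are larger) is almost `ω^ω`-bounding. -/
def AlmostBounding (Q : Type*) [Preorder Q] : Prop :=
  ∀ (τ : BaireName Q) (p : Q), ∃ g : ℕ → ℕ, ∀ B : Set ℕ, B.Infinite →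
    ∃ q, p ≤ q ∧ τ.ForcesInfOften q B g

end Creatures

namespace Creatures

universe u v

/-! ## Compactness and pre-norms -/

/-! Bounding from the AB-type. Given a name `τ` and a condition, a fusion yields a pure extension
`t` each of whose tails, from any root, already decides `τ(m)` whenever some pure extension of it
does, for `m` up to the length of the root (`exists_fusion`). Apply the second AB condition at `m`
to the decision function that waits for a possibility at which the tail of `t` decides `τ(m)`. The
result is a creature `s ∈ Σ(t_m, …, t_{n-1})` such that every positive-norm element of `Σ(s)`
retains a deciding possibility (`Fused.exists_block`). Only finitely many possibilities exist, so
one bound `g(m)` serves, and it is chosen before the infinite set `B`. For given `B`, sparse `m ∈ B`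
are picked, their creatures are prolonged to the left by the first AB condition until they abut
(`Fused.exists_prolongation`), and the resulting creatures `T_i` form `q`. A creature of any
extension of `q` is composed from some of the `T_i`. Condensation puts below its possibilities all
those of a positive-norm element of some `Σ(T_i)`, hence a deciding one, and smoothness turns this
into an extension forcing `τ(m) < g(m)`.

AB-type from halving and saturation. For the first condition, stretch `t_k` by zeros over the whole
interval. For the second, call a set `X` of indices good if, for some `n`, all choices of
positive-norm `s_i ∈ Σ(half(t_i))` at the indices of `X` below `n` leave in their sum a possibility
extending a value of the decision function. Every infinite `X` has a good initial segment: for a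
single choice, halving is undone and the creatures obtained are stretched over the gaps of `X` to a
pure candidate, at which the decision function has a value (`exists_reaches`). Strong finitariness
and compactness make `n` uniform. Iterating "one half of every partition is still good" converts
goodness into a nice pre-norm that is large at a finite `u` (`exists_nicePreNorm`). The sum of the
`half(t_i)` over `u` is the required creature, because by saturation each of its positive-norm
successors contains a sum over a good subset of `u`. -/

theorem exists_uniform_bound {F : ℕ → Type*} [∀ i, Finite (F i)] (R : ℕ → (∀ i, F i) → Prop)
    (mono : ∀ n s, R n s → R (n + 1) s)
    (local_ : ∀ n s s', (∀ i, i < n → s i = s' i) → R n s → R n s')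
    (h : ∀ s, ∃ n, R n s) : ∃ n, ∀ s, R n s := by
  -- With finite discrete factors the product is compact. Since `R n` reads only the first `n`
  -- coordinates, the sets `{s | R n s}` form an increasing open cover.
  let _ : ∀ i, TopologicalSpace (F i) := fun i => ⊥
  have : ∀ i, DiscreteTopology (F i) := fun i => ⟨rfl⟩
  have hmono : Monotone R := monotone_nat_of_le_succ mono
  obtain ⟨n, hn⟩ := isCompact_univ.elim_directed_cover (fun n => {s | R n s})
    (fun n => by
      rw [isOpen_iff_mem_nhds]
      intro s hs
      have : {s' | ∀ i ∈ Finset.range n, s' i = s i} ∈ nhds s := by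
        simp only [Set.ofPred_forall]
        refine (Filter.biInter_finset_mem _).2 fun i _ => ?_
        exact ((isOpen_discrete {s i}).preimage (continuous_apply i)).mem_nhds rfl
      refine Filter.mem_of_superset this fun s' hs' => local_ n s s' (fun i hi => ?_) hs
      exact (hs' i (Finset.mem_range.2 hi)).symm)
    (fun s _ => Set.mem_iUnion.2 (h s))
    (directed_of_isDirected_le fun i j hij s => hmono hij s)
  exact ⟨n, fun s => hn (Set.mem_univ s)⟩

/-- The iterated splitting ranks `≥ 1`, `≥ 2`, … over a monotone predicate on sets of naturals. -/
def SplitRank (G : Set ℕ → Prop) : ℕ → Set ℕ → Prop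
  | 0, u => G u ∧ u.Nonempty
  | k + 1, u => u.Nontrivial ∧ ∀ B, B ⊆ u → SplitRank G k B ∨ SplitRank G k (u \ B)

/-! ### Splitting ranks and the pre-norms they induce -/

section SplitRank

variable {G : Set ℕ → Prop}

theorem SplitRank.mono (hG : ∀ B C, B ⊆ C → G B → G C) {k : ℕ} {B C : Set ℕ} (hBC : B ⊆ C)
    (h : SplitRank G k B) : SplitRank G k C := by
  induction k generalizing B C with
  | zero => exact ⟨hG B C hBC h.1, h.2.mono hBC⟩
  | succ k ih =>
    refine ⟨h.1.mono hBC, fun E _ => ?_⟩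
    rcases h.2 (E ∩ B) Set.inter_subset_right with h' | h'
    · exact Or.inl (ih Set.inter_subset_left h')
    · refine Or.inr (ih ?_ h')
      rintro x ⟨hx, hxE⟩
      exact ⟨hBC hx, fun hE => hxE ⟨hE, hx⟩⟩

theorem SplitRank.zero_of {k : ℕ} {B : Set ℕ}
    (h : SplitRank G k B) : G B ∧ B.Nonempty := by
  induction k generalizing B with
  | zero => exact h
  | succ k ih =>
    rcases h.2 ∅ (Set.empty_subset B) with h' | h'
    · exact absurd (ih h').2 Set.not_nonempty_empty
    · exact ih (by simpa using h')

/-- Every two-colouring of an infinite set has an infinite colour class, which by induction has an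
initial segment of rank `k`. Compactness of the space of colourings gives one `n` below which this
always happens, so every partition of `X ∩ n` has a side of rank `k`. -/
theorem SplitRank.exists_finite (hG : ∀ B C, B ⊆ C → G B → G C)
    (hX : ∀ X : Set ℕ, X.Infinite → ∃ n, G (X ∩ Set.Iio n)) (k : ℕ) {X : Set ℕ}
    (hinf : X.Infinite) : ∃ n, SplitRank G k (X ∩ Set.Iio n) := by
  have hIio : ∀ (Y : Set ℕ) {m n : ℕ}, m ≤ n → Y ∩ Set.Iio m ⊆ Y ∩ Set.Iio n := fun Y m n h =>
    Set.inter_subset_inter_right Y (Set.Iio_subset_Iio h)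
  induction k generalizing X with
  | zero =>
    obtain ⟨n, hn⟩ := hX X hinf
    obtain ⟨x, hx⟩ := hinf.nonempty
    exact ⟨max n (x + 1), hG _ _ (hIio X (le_max_left _ _)) hn,
      x, hx, lt_of_lt_of_le x.lt_succ_self (le_max_right _ _)⟩
  | succ k ih =>
    obtain ⟨n, hn⟩ := exists_uniform_bound (F := fun _ => Bool)
      (fun n s => SplitRank G k ({i | i ∈ X ∧ s i = true} ∩ Set.Iio n) ∨
        SplitRank G k ({i | i ∈ X ∧ s i = false} ∩ Set.Iio n))
      (fun n s => Or.imp (SplitRank.mono hG (hIio _ n.le_succ))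
        (SplitRank.mono hG (hIio _ n.le_succ)))
      (fun n s s' hs => by
        have h : ∀ b, ({i | i ∈ X ∧ s i = b} ∩ Set.Iio n) = {i | i ∈ X ∧ s' i = b} ∩ Set.Iio n := by
          intro b; ext i
          simp only [Set.mem_inter_iff, Set.mem_ofPred_eq, Set.mem_Iio]
          constructor
          · rintro ⟨⟨h1, h2⟩, h3⟩; exact ⟨⟨h1, (hs i h3).symm.trans h2⟩, h3⟩
          · rintro ⟨⟨h1, h2⟩, h3⟩; exact ⟨⟨h1, (hs i h3).trans h2⟩, h3⟩
        rw [h, h]; exact id)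
      (fun s => by
        have hu : X = {i | i ∈ X ∧ s i = true} ∪ {i | i ∈ X ∧ s i = false} := by
          ext i
          cases h : s i <;> simp [h]
        rw [hu, Set.infinite_union] at hinf
        rcases hinf with h | h
        · obtain ⟨n, hn⟩ := ih h; exact ⟨n, Or.inl hn⟩
        · obtain ⟨n, hn⟩ := ih h; exact ⟨n, Or.inr hn⟩)
    obtain ⟨x, hx⟩ := hinf.nonempty
    obtain ⟨y, hy, hxy⟩ := hinf.exists_gt x
    classical
    have hsplit : ∀ m, n ≤ m → ∀ B, B ⊆ X ∩ Set.Iio m →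
        SplitRank G k B ∨ SplitRank G k ((X ∩ Set.Iio m) \ B) := by
      intro m hm B hB
      refine (hn fun i => decide (i ∈ B)).imp (SplitRank.mono hG ?_) (SplitRank.mono hG ?_)
      · rintro i ⟨⟨-, hi⟩, -⟩
        simpa using hi
      · rintro i ⟨⟨h1, hi⟩, h2⟩
        exact ⟨⟨h1, lt_of_lt_of_le h2 hm⟩, by simpa using hi⟩
    -- Going beyond `y` puts two points into the initial segment, as the nontriviality clause of the
    -- rank demands.
    refine ⟨max n (y + 1), ⟨x, ⟨hx, ?_⟩, y, ⟨hy, ?_⟩, hxy.ne⟩, hsplit _ (le_max_left _ _)⟩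
    · exact lt_of_lt_of_le (hxy.trans y.lt_succ_self) (le_max_right _ _)
    · exact lt_of_lt_of_le y.lt_succ_self (le_max_right _ _)

/-- A monotone predicate which holds at an initial segment of every infinite set gives rise to nice
pre-norms with values in `ω` which are large at some finite set. -/
theorem exists_nicePreNorm (hG : ∀ B C, B ⊆ C → G B → G C)
    (hX : ∀ X : Set ℕ, X.Infinite → ∃ n, G (X ∩ Set.Iio n)) (M : ℕ) :
    ∃ N : Set ℕ → ℝ≥0, IsNicePreNorm N ∧ (∀ u, ∃ n : ℕ, N u = n) ∧
      (∀ u, 0 < N u → G u ∧ u.Nonempty) ∧ ∃ u : Finset ℕ, (M : ℝ≥0) < N u := by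
  classical
  -- The pre-norm is the rank plus one, or `0` if there is no rank. Capping it at `M + 1` keeps it
  -- finite on infinite sets and still allows values above `M`. The nontriviality clause keeps
  -- singletons at norm at most `1`.
  let Q : Set ℕ → ℕ → Prop := fun u k => k = 0 ∨ SplitRank G (k - 1) u
  let f : Set ℕ → ℕ := fun u => Nat.findGreatest (Q u) (M + 1)
  have hQ : ∀ u, Q u (f u) := fun u => Nat.findGreatest_spec (Nat.zero_le _) (Or.inl rfl)
  have hle : ∀ u k, k ≤ M → SplitRank G k u → k + 1 ≤ f u := fun u k hk h =>
    Nat.le_findGreatest (Nat.succ_le_succ hk) (Or.inr h)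
  have hrank : ∀ u, 0 < f u → SplitRank G (f u - 1) u := fun u h => (hQ u).resolve_left h.ne'
  have hbd : ∀ u, f u ≤ M + 1 := fun u => Nat.findGreatest_le _
  have hlarge : ∃ u : Finset ℕ, M < f u := by
    obtain ⟨n, hn⟩ := SplitRank.exists_finite hG hX M Set.infinite_univ
    refine ⟨Finset.range n, hle _ M le_rfl ?_⟩
    rw [Set.univ_inter] at hn
    simpa using hn
  have hmono : ∀ B C, B ⊆ C → f B ≤ f C := by
    intro B C hBC
    rcases Nat.eq_zero_or_pos (f B) with h | h
    · rw [h]; exact Nat.zero_le _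
    · have := hle C (f B - 1) (by have := hbd B; omega) ((hrank B h).mono hG hBC)
      omega
  refine ⟨fun u => f u, ⟨fun B C h => by exact_mod_cast hmono B C h, ?_, fun a => ?_,
    fun B C hBC hC => ?_⟩, fun u => ⟨f u, rfl⟩, fun u hu => ?_, ?_⟩
  · obtain ⟨u, hu⟩ := hlarge
    exact_mod_cast (Nat.zero_lt_of_lt hu).trans_le (hmono u _ (Set.subset_univ _))
  · have : f {a} ≤ 1 := by
      by_contra! h
      have h' := hrank {a} (by omega)
      obtain ⟨k, hk⟩ : ∃ k, f {a} - 1 = k + 1 := ⟨f {a} - 2, by omega⟩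
      rw [hk] at h'
      exact Set.not_nontrivial_singleton h'.1
    exact_mod_cast this
  · have hC' : 1 < f C := by exact_mod_cast hC
    have h' := hrank C (by omega)
    obtain ⟨k, hk⟩ : ∃ k, f C = k + 2 := ⟨f C - 2, by omega⟩
    have hkM : k ≤ M := by have := hbd C; omega
    rw [hk] at h'
    have key : ∀ E, SplitRank G k E → (f C : ℝ≥0) - 1 ≤ f E := by
      intro E hE
      rw [tsub_le_iff_right]
      exact_mod_cast (by have := hle E k hkM hE; omega : f C ≤ f E + 1)
    exact (h'.2 B hBC).imp (key _) (key _)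
  · exact (hrank u (Nat.cast_pos.1 hu)).zero_of
  · obtain ⟨u, hu⟩ := hlarge
    exact ⟨u, Nat.cast_lt.2 hu⟩

end SplitRank

variable {A : Type u} {D : Type v} {H : Alphabet A}

/-! ## Segments -/

theorem seg_self {X : Type*} (t : ℕ → X) (a : ℕ) : seg t a a = [] := by simp [seg]

theorem seg_succ {X : Type*} (t : ℕ → X) (a : ℕ) : seg t a (a + 1) = [t a] := by simp [seg]

theorem seg_succ_right {X : Type*} (t : ℕ → X) {a b : ℕ} (h : a ≤ b) :
    seg t a (b + 1) = seg t a b ++ [t b] := by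
  rw [← seg_succ, CreatingPair.seg_append t h b.le_succ]

theorem seg_cons {X : Type*} (t : ℕ → X) {a b : ℕ} (h : a < b) :
    seg t a b = t a :: seg t (a + 1) b := by
  rw [← CreatingPair.seg_append t a.le_succ h, seg_succ]; rfl

theorem seg_shift {X : Type*} (t : ℕ → X) (n a b : ℕ) :
    seg (fun i => t (n + i)) a b = seg t (n + a) (n + b) := by
  have h := List.map_add_range' (a := n) a (b - a) 1
  have e : n + b - (n + a) = b - a := by omega
  rw [seg, seg, e, ← h, List.map_map]; rfl

theorem seg_eq_nil {X : Type*} (t : ℕ → X) {a b : ℕ} (h : b ≤ a) : seg t a b = [] := by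
  simp [seg, Nat.sub_eq_zero_of_le h]

theorem seg_ne_nil {X : Type*} (t : ℕ → X) {a b : ℕ} (h : a < b) : seg t a b ≠ [] := by
  rw [seg_cons t h]; simp

theorem seg_congr {X : Type*} {s t : ℕ → X} {a b : ℕ} (h : ∀ i, a ≤ i → i < b → s i = t i) :
    seg s a b = seg t a b := by
  rw [seg, seg, List.map_inj_left]
  intro i hi
  rw [List.mem_range'_1] at hi
  exact h i hi.1 (by omega)

theorem head_seg {X : Type*} (t : ℕ → X) {a b : ℕ} (h : a < b) :
    (seg t a b).head (seg_ne_nil t h) = t a := by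
  simp [seg_cons t h]

theorem getLast_seg {X : Type*} (t : ℕ → X) {a b : ℕ} (h : a ≤ b) :
    (seg t a (b + 1)).getLast (seg_ne_nil t (Nat.lt_succ_of_le h)) = t b := by
  simp [seg_succ_right t h]

/-! ## Sequences -/

theorem getElem?_of_prefix {w w' : List A} (hw : w <+: w') {i : ℕ} {a : A}
    (h : w[i]? = some a) : w'[i]? = some a := by
  obtain ⟨l, rfl⟩ := hw
  rw [List.getElem?_append_left (List.getElem?_eq_some_iff.1 h).1, h]

theorem Alphabet.length_zeros (a b : ℕ) : (H.zeros a b).length = b - a := by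
  simp [Alphabet.zeros]

theorem Alphabet.zeros_append {a b c : ℕ} (h : a ≤ b) (h' : b ≤ c) :
    H.zeros a b ++ H.zeros b c = H.zeros a c :=
  CreatingPair.seg_append H.zero h h'

theorem Alphabet.zeroOn_append_zeros {w : List A} {a b : ℕ} (h : w.length = a) :
    H.ZeroOn (w ++ H.zeros a b) a b := by
  intro i h1 h2
  rw [List.getElem?_append_right (by omega), Alphabet.zeros, List.getElem?_map,
    List.getElem?_range' (by omega)]
  simp; congr 1; omega

theorem Alphabet.IsSeq.append_zeros {w : List A} (hw : H.IsSeq w) {a b : ℕ} (h : w.length = a) :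
    H.IsSeq (w ++ H.zeros a b) := by
  intro i x hx
  by_cases hi : i < a
  · rw [List.getElem?_append_left (by omega)] at hx
    exact hw i x hx
  · have hib : i < b := by
      have := (List.getElem?_eq_some_iff.1 hx).1
      rw [List.length_append, H.length_zeros] at this
      omega
    rw [zeroOn_append_zeros h i (by omega) hib] at hx
    cases hx
    exact H.zero_mem i

/-- A sequence which vanishes on `[a, b)` is there given by zeros. -/
theorem Alphabet.ZeroOn.take_eq {w : List A} {a b : ℕ} (h : H.ZeroOn w a b) (hab : a ≤ b)
    (ha : a ≤ w.length) : w.take b = w.take a ++ H.zeros a b := by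
  apply List.ext_getElem?
  intro i
  have hla : (w.take a).length = a := by simp [ha]
  by_cases hi : i < a
  · rw [List.getElem?_append_left (by omega), List.getElem?_take_of_lt (by omega),
      List.getElem?_take_of_lt hi]
  · by_cases hib : i < b
    · rw [zeroOn_append_zeros hla i (by omega) hib, List.getElem?_take_of_lt hib,
        h i (by omega) hib]
    · rw [List.getElem?_eq_none (by simp; omega), List.getElem?_eq_none]
      rw [List.length_append, H.length_zeros]; omega

theorem Alphabet.ZeroOn.mono {w : List A} {a b a' b' : ℕ} (h : H.ZeroOn w a b) (ha : a ≤ a')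
    (hb : b' ≤ b) : H.ZeroOn w a' b' :=
  fun i h1 h2 => h i (ha.trans h1) (h2.trans_le hb)

theorem Alphabet.ZeroOn.of_prefix {w w' : List A} {a b : ℕ} (h : H.ZeroOn w a b) (hw : w <+: w') :
    H.ZeroOn w' a b :=
  fun i h1 h2 => getElem?_of_prefix hw (h i h1 h2)

theorem Alphabet.finite_isSeq (hH : ∀ m, (H.carrier m).Finite) (n : ℕ) :
    {w : List A | H.IsSeq w ∧ w.length = n}.Finite := by
  have hs : (⋃ m ∈ Finset.range n, H.carrier m).Finite :=
    (Finset.range n).finite_toSet.biUnion fun m _ => hH m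
  have : Finite (⋃ m ∈ Finset.range n, H.carrier m) := hs
  refine (List.finite_length_eq (⋃ m ∈ Finset.range n, H.carrier m) n).image
    (List.map Subtype.val) |>.subset ?_
  rintro w ⟨hw, hn⟩
  have hw' : ∀ a ∈ w, a ∈ ⋃ m ∈ Finset.range n, H.carrier m := by
    intro a ha
    obtain ⟨i, hi⟩ := List.mem_iff_getElem?.1 ha
    have hlt := (List.getElem?_eq_some_iff.1 hi).1
    simp only [Set.mem_iUnion, Finset.mem_range]
    exact ⟨i, by omega, hw i a hi⟩
  lift w to List (⋃ m ∈ Finset.range n, H.carrier m) using hw'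
  exact ⟨w, by simpa using hn, rfl⟩

/-! ## Norms -/

theorem minNor_attained (t : ℕ → WeakCreature A D) {a b : ℕ} (h : a < b) :
    ∃ i, a ≤ i ∧ i < b ∧ minNor t a b = (t i).nor := by
  have hne : ((fun i => (t i).nor) '' Set.Ico a b).Nonempty := ⟨_, a, ⟨le_rfl, h⟩, rfl⟩
  obtain ⟨i, hi, he⟩ := hne.csInf_mem ((Set.finite_Ico a b).image _)
  exact ⟨i, hi.1, hi.2, he.symm⟩

theorem minNor_le (t : ℕ → WeakCreature A D) {a b i : ℕ} (ha : a ≤ i) (hb : i < b) :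
    minNor t a b ≤ (t i).nor :=
  csInf_le (OrderBot.bddBelow _) ⟨i, ⟨ha, hb⟩, rfl⟩

namespace CreatingPair

variable {P : CreatingPair H D}

/-! ## Lengths -/

theorem length_of_mem_val {t : WeakCreature A D} (ht : t ∈ P.K) {x y : List A}
    (h : (x, y) ∈ t.val) : x.length = t.mdn ∧ y.length = t.mup :=
  (P.isCreature t ht).2 _ h

theorem prefix_of_mem_val {t : WeakCreature A D} (ht : t ∈ P.K) {x y : List A}
    (h : (x, y) ∈ t.val) : H.IsSeq x ∧ H.IsSeq y ∧ x <+: y ∧ x ≠ y :=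
  (P.isCreature t ht).1.2 x y h

theorem mdn_lt_mup {t : WeakCreature A D} (ht : t ∈ P.K) : t.mdn < t.mup := by
  obtain ⟨⟨x, y⟩, hx⟩ := (P.isCreature t ht).1.1
  obtain ⟨h1, h2⟩ := length_of_mem_val ht hx
  obtain ⟨-, -, h3, h4⟩ := prefix_of_mem_val ht hx
  rw [← h1, ← h2]
  exact lt_of_le_of_ne h3.length_le fun h => h4 (h3.eq_of_length h)

theorem mdn_of_mem_sig {t s : WeakCreature A D} (h : s ∈ P.Sig [t]) :
    s.mdn = t.mdn ∧ s.mup = t.mup :=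
  ⟨P.sig_mdn [t] (by simp) s h, P.sig_mup [t] (by simp) s h⟩

theorem mem_K_of_mem_sig {t s : WeakCreature A D} (h : s ∈ P.Sig [t]) : t ∈ P.K :=
  P.mem_of_sig _ ⟨s, h⟩ t (by simp)

theorem sig_mono {t s : WeakCreature A D} {l : List (WeakCreature A D)} (h : s ∈ P.Sig l)
    (ht : t ∈ P.Sig [s]) : t ∈ P.Sig l := by
  simpa using P.sig_trans [s] [l] (by simpa using h) ht

theorem length_of_mem_basis {t : WeakCreature A D} {w : List A} (h : w ∈ P.basis t) :
    w.length = t.mdn ∧ H.IsSeq w := by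
  obtain ⟨s, hs, u, hu⟩ := h
  have hK := P.sig_subset _ hs
  exact ⟨(length_of_mem_val hK hu).1.trans (mdn_of_mem_sig hs).1, (prefix_of_mem_val hK hu).1⟩

/-- A sequence of elements of `K` each of which begins where the previous one ends. -/
def Linked (P : CreatingPair H D) (t : ℕ → WeakCreature A D) : Prop :=
  ∀ i, t i ∈ P.K ∧ (t i).mup = (t (i + 1)).mdn

theorem Linked.strictMono {t : ℕ → WeakCreature A D} (ht : P.Linked t) :
    StrictMono fun i => (t i).mdn :=
  strictMono_nat_of_lt_succ fun i => (mdn_lt_mup (ht i).1).trans_eq (ht i).2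

theorem Linked.le_mdn {t : ℕ → WeakCreature A D} (ht : P.Linked t) (i : ℕ) : i ≤ (t i).mdn :=
  ht.strictMono.le_apply

theorem Linked.shift {t : ℕ → WeakCreature A D} (ht : P.Linked t) (n : ℕ) :
    P.Linked fun i => t (n + i) :=
  fun i => ht (n + i)

theorem Candidate.linked {w : List A} {t : ℕ → WeakCreature A D} (h : P.Candidate w t) :
    P.Linked t :=
  fun i => ⟨(h i).1, (h i).2.1⟩

theorem Linked.of_mem_sig {t : ℕ → WeakCreature A D} (ht : P.Linked t) {a b : ℕ}
    {s : WeakCreature A D} (hs : s ∈ P.Sig (seg t a b)) :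
    a < b ∧ s.mdn = (t a).mdn ∧ s.mup = (t b).mdn := by
  have hab : a < b := by
    by_contra h
    rw [seg_eq_nil t (not_lt.1 h), P.sig_nil] at hs
    exact hs
  refine ⟨hab, ?_, ?_⟩
  · rw [P.sig_mdn _ (seg_ne_nil t hab) s hs, head_seg t hab]
  · obtain ⟨c, rfl⟩ := Nat.exists_eq_succ_of_ne_zero (Nat.ne_of_gt (Nat.zero_lt_of_lt hab))
    rw [P.sig_mup _ (seg_ne_nil t hab) s hs]
    exact (congrArg WeakCreature.mup (getLast_seg t (Nat.le_of_lt_succ hab))).trans (ht c).2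

theorem Pos.prefix {w u : List A} {l : List (WeakCreature A D)} (h : P.Pos w l u) : w <+: u := by
  induction h with
  | nil => exact List.prefix_rfl
  | step _ hs hv ih => exact ih.trans (prefix_of_mem_val (P.sig_subset _ hs) hv).2.2.1

theorem Pos.isSeq {w u : List A} {l : List (WeakCreature A D)} (h : P.Pos w l u)
    (hw : H.IsSeq w) : H.IsSeq u := by
  induction h with
  | nil => exact hw
  | step _ hs hv ih => exact (prefix_of_mem_val (P.sig_subset _ hs) hv).2.1

theorem Pos.length_eq {w u : List A} {l : List (WeakCreature A D)} (h : P.Pos w l u)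
    (hl : l ≠ []) : u.length = (l.getLast hl).mup := by
  cases h with
  | nil => exact absurd rfl hl
  | @step l l' u v s _ hs hv =>
    have hl' : l' ≠ [] := by
      rintro rfl
      rw [P.sig_nil] at hs; exact hs
    rw [(length_of_mem_val (P.sig_subset _ hs) hv).2, P.sig_mup l' hl' s hs,
      List.getLast_append_of_ne_nil _ hl']

theorem Linked.length_pos {t : ℕ → WeakCreature A D} (ht : P.Linked t) {w u : List A} {a b : ℕ}
    (hw : w.length = (t a).mdn) (hab : a ≤ b) (h : u ∈ P.pos w (seg t a b)) :
    u.length = (t b).mdn := by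
  rcases hab.eq_or_lt with rfl | hab
  · rw [seg_self] at h
    generalize hl : ([] : List (WeakCreature A D)) = l at h
    cases h with
    | nil => exact hw
    | step _ hs _ =>
      obtain ⟨rfl, rfl⟩ := List.append_eq_nil_iff.1 hl.symm
      rw [P.sig_nil] at hs; exact hs.elim
  · obtain ⟨c, rfl⟩ := Nat.exists_eq_succ_of_ne_zero (Nat.ne_of_gt (Nat.zero_lt_of_lt hab))
    rw [Pos.length_eq h (seg_ne_nil t hab)]
    exact (congrArg WeakCreature.mup (getLast_seg t (Nat.le_of_lt_succ hab))).trans (ht c).2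

theorem mem_pos_nil {w u : List A} : u ∈ P.pos w [] ↔ u = w := by
  constructor
  · intro h
    generalize hl : ([] : List (WeakCreature A D)) = l at h
    cases h with
    | nil => rfl
    | step _ hs _ =>
      obtain ⟨rfl, rfl⟩ := List.append_eq_nil_iff.1 hl.symm
      rw [P.sig_nil] at hs; exact hs.elim
  · rintro rfl; exact Pos.nil

theorem mem_pos_singleton {w u : List A} {t : WeakCreature A D} :
    u ∈ P.pos w [t] ↔ ∃ s ∈ P.Sig [t], (w, u) ∈ s.val := by
  constructor
  · intro h
    generalize hl : [t] = l at h
    cases h with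
    | nil => simp at hl
    | @step l l' u v s hu hs hv =>
      rcases List.append_eq_singleton_iff.1 hl.symm with ⟨rfl, rfl⟩ | ⟨rfl, rfl⟩
      · rw [mem_pos_nil.1 hu] at hv
        exact ⟨s, hs, hv⟩
      · rw [P.sig_nil] at hs; exact hs.elim
  · rintro ⟨s, hs, hv⟩
    exact Pos.step (l := []) Pos.nil hs hv

theorem mem_pos_of_val {w u : List A} {t : WeakCreature A D} (ht : t ∈ P.K)
    (h : (w, u) ∈ t.val) : u ∈ P.pos w [t] :=
  mem_pos_singleton.2 ⟨t, P.sig_self t ht, h⟩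

theorem mem_pos_one {w u : List A} {s : WeakCreature A D} {l : List (WeakCreature A D)}
    (hs : s ∈ P.Sig l) (h : u ∈ P.pos w [s]) : u ∈ P.pos w l := by
  have := Pos.refine h [l] (by simpa using hs)
  rwa [List.flatten_singleton] at this

theorem ValMonotone.mem_val (hv : P.ValMonotone) {w u : List A} {t : WeakCreature A D}
    (h : u ∈ P.pos w [t]) : (w, u) ∈ t.val := by
  obtain ⟨s, hs, hsv⟩ := mem_pos_singleton.1 h
  exact hv t (mem_K_of_mem_sig hs) s hs hsv

theorem exists_mem_pos_of_basis {w : List A} {t : WeakCreature A D} (h : w ∈ P.basis t) :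
    ∃ u, u ∈ P.pos w [t] := by
  obtain ⟨s, hs, u, hu⟩ := h
  exact ⟨u, mem_pos_singleton.2 ⟨s, hs, hu⟩⟩

/-! ## Refinements of candidates -/

theorem Candidate.length_eq {w : List A} {t : ℕ → WeakCreature A D} (h : P.Candidate w t) :
    w.length = (t 0).mdn ∧ H.IsSeq w := by
  refine length_of_mem_basis ((h 0).2.2 ?_)
  rw [seg_self]; exact Pos.nil

theorem Candidate.length_pos {w u : List A} {t : ℕ → WeakCreature A D} (h : P.Candidate w t)
    {n : ℕ} (hu : u ∈ P.pos w (seg t 0 n)) : u.length = (t n).mdn :=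
  h.linked.length_pos h.length_eq.1 (Nat.zero_le n) hu

theorem Candidate.mem_pos_succ {w u : List A} {t : ℕ → WeakCreature A D} (h : P.Candidate w t)
    {n : ℕ} (hu : u ∈ P.pos w (seg t 0 n)) :
    ∃ u', u' ∈ P.pos u [t n] ∧ u' ∈ P.pos w (seg t 0 (n + 1)) := by
  obtain ⟨u', hu'⟩ := exists_mem_pos_of_basis ((h n).2.2 hu)
  refine ⟨u', hu', ?_⟩
  rw [seg_succ_right t (Nat.zero_le n)]
  exact Pos.trans hu hu'

theorem Candidate.pos_nonempty {w : List A} {t : ℕ → WeakCreature A D} (h : P.Candidate w t)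
    (n : ℕ) : (P.pos w (seg t 0 n)).Nonempty := by
  induction n with
  | zero => exact ⟨w, by rw [seg_self]; exact Pos.nil⟩
  | succ n ih =>
    obtain ⟨u, hu⟩ := ih
    obtain ⟨u', -, hu'⟩ := h.mem_pos_succ hu
    exact ⟨u', hu'⟩

theorem pos_refine {w u : List A} {s t : ℕ → WeakCreature A D} {k : ℕ → ℕ} (hk : StrictMono k)
    (hs : ∀ i, s i ∈ P.Sig (seg t (k i) (k (i + 1)))) {a b : ℕ} (hab : a ≤ b)
    (hu : u ∈ P.pos w (seg s a b)) : u ∈ P.pos w (seg t (k a) (k b)) := by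
  rw [← seg_flatten t hk hab]
  exact Pos.refine hu _ (forall₂_seg (R := fun s S => s ∈ P.Sig S) hs a b)

theorem sig_refine {r : WeakCreature A D} {s t : ℕ → WeakCreature A D} {k : ℕ → ℕ}
    (hk : StrictMono k) (hs : ∀ i, s i ∈ P.Sig (seg t (k i) (k (i + 1)))) {a b : ℕ} (hab : a ≤ b)
    (hu : r ∈ P.Sig (seg s a b)) : r ∈ P.Sig (seg t (k a) (k b)) := by
  rw [← seg_flatten t hk hab]
  exact P.sig_trans _ _ (forall₂_seg (R := fun s S => s ∈ P.Sig S) hs a b) hu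

theorem pos_append {w u v : List A} {t : ℕ → WeakCreature A D} {a b c : ℕ} (hab : a ≤ b)
    (hbc : b ≤ c) (hu : u ∈ P.pos w (seg t a b)) (hv : v ∈ P.pos u (seg t b c)) :
    v ∈ P.pos w (seg t a c) := by
  rw [← seg_append t hab hbc]
  exact Pos.trans hu hv

theorem Nice.basis_seg (hn : P.Nice) {s : WeakCreature A D} {t : ℕ → WeakCreature A D} {a b : ℕ}
    (hs : s ∈ P.Sig (seg t a b)) (hab : a < b) : P.basis (t a) ⊆ P.basis s := by
  rw [seg_cons t hab] at hs
  exact hn _ _ s hs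

theorem Linked.refine {s t : ℕ → WeakCreature A D} (h : P.Linked t) {k : ℕ → ℕ}
    (hs : ∀ i, s i ∈ P.Sig (seg t (k i) (k (i + 1)))) : P.Linked s := fun i =>
  ⟨P.sig_subset _ (hs i), (h.of_mem_sig (hs i)).2.2.trans (h.of_mem_sig (hs (i + 1))).2.1.symm⟩

theorem Candidate.refine (hn : P.Nice) {w v : List A} {s t : ℕ → WeakCreature A D}
    (h : P.Candidate w t) {k : ℕ → ℕ} (hk : StrictMono k)
    (hs : ∀ i, s i ∈ P.Sig (seg t (k i) (k (i + 1)))) (hv : v ∈ P.pos w (seg t 0 (k 0))) :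
    P.Candidate v s := fun i => by
  refine ⟨(h.linked.refine hs i).1, (h.linked.refine hs i).2, fun u hu => ?_⟩
  exact hn.basis_seg (hs i) (hk i.lt_succ_self) ((h _).2.2
    (pos_append (Nat.zero_le _) (hk.monotone i.zero_le) hv (pos_refine hk hs i.zero_le hu)))

theorem Candidate.tail (hn : P.Nice) {w v : List A} {t : ℕ → WeakCreature A D}
    (h : P.Candidate w t) {n : ℕ} (hv : v ∈ P.pos w (seg t 0 n)) :
    P.Candidate v fun i => t (n + i) :=
  h.refine hn (k := fun i => n + i) (strictMono_id.const_add n)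
    (fun i => by rw [← add_assoc, seg_succ]; exact P.sig_self _ (h _).1) hv

theorem Candidate.pcle (hn : P.Nice) {w : List A} {s t : ℕ → WeakCreature A D}
    (h : P.Candidate w t) (hs : P.PCLe t s) : P.Candidate w s := by
  obtain ⟨k, hk, h0, hs⟩ := hs
  refine h.refine hn hk hs ?_
  rw [h0, seg_self]; exact Pos.nil

theorem Candidate.fc {w v : List A} {t : ℕ → WeakCreature A D} (h : P.Candidate w t) {a b : ℕ}
    (hab : a < b) (hv : v ∈ P.pos w (seg t 0 a)) : P.FC v t a b :=
  ⟨hab, fun i hi _ => ⟨(h i).1, fun _ hu => (h i).2.2 (pos_append a.zero_le hi hv hu)⟩,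
    fun i _ _ => (h i).2.1⟩

theorem PCLe.refl {t : ℕ → WeakCreature A D} (h : ∀ i, t i ∈ P.K) : P.PCLe t t :=
  ⟨id, strictMono_id, rfl, fun i => by simpa [seg_succ] using P.sig_self _ (h i)⟩

theorem PCLe.trans {r s t : ℕ → WeakCreature A D} (h : P.PCLe t s) (h' : P.PCLe s r) :
    P.PCLe t r := by
  obtain ⟨k, hk, h0, hs⟩ := h
  obtain ⟨j, hj, h0', hr⟩ := h'
  exact ⟨k ∘ j, hk.comp hj, by simp [h0, h0'],
    fun i => sig_refine hk hs (hj.monotone i.le_succ) (hr i)⟩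

theorem PCLe.linked {s t : ℕ → WeakCreature A D} (h : P.PCLe t s) (ht : P.Linked t) :
    P.Linked s := by
  obtain ⟨k, _, _, hs⟩ := h
  exact ht.refine hs

theorem PCLe.mdn_zero {s t : ℕ → WeakCreature A D} (h : P.PCLe t s) (ht : P.Linked t) :
    (s 0).mdn = (t 0).mdn := by
  obtain ⟨k, _, h0, hs⟩ := h
  rw [(ht.of_mem_sig (hs 0)).2.1, h0]

/-- The numbers `m_dn(t_i)` are strictly increasing, so the ends of each `s_i` determine the segment
of `t` it was built from. Separately chosen segments therefore fit together. -/
theorem PCLe.of_pieces {s t : ℕ → WeakCreature A D} (ht : P.Linked t) (hs : P.Linked s)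
    (h0 : (s 0).mdn = (t 0).mdn) (h : ∀ i, ∃ a b, s i ∈ P.Sig (seg t a b)) : P.PCLe t s := by
  choose a b hab using h
  have hb : ∀ i, b i = a (i + 1) := fun i => ht.strictMono.injective
    ((ht.of_mem_sig (hab i)).2.2.symm.trans ((hs i).2.trans (ht.of_mem_sig (hab (i + 1))).2.1))
  refine ⟨a, strictMono_nat_of_lt_succ fun i => ?_, ht.strictMono.injective
    ((ht.of_mem_sig (hab 0)).2.1.symm.trans h0), fun i => ?_⟩
  · rw [← hb]; exact (ht.of_mem_sig (hab i)).1
  · rw [← hb]; exact hab i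

theorem Finitary.finite_pos (hf : P.Finitary) {w : List A} {t : ℕ → WeakCreature A D}
    (h : P.Candidate w t) (n : ℕ) : (P.pos w (seg t 0 n)).Finite :=
  (H.finite_isSeq hf.1 (t n).mdn).subset fun _ hu =>
    ⟨Pos.isSeq hu h.length_eq.2, h.length_pos hu⟩

theorem Equivalent.symm {s t : WeakCreature A D} (h : P.Equivalent s t) : P.Equivalent t s :=
  ⟨h.2.1, h.1, h.2.2.1.symm, h.2.2.2.1.symm, fun l l' => (h.2.2.2.2 l l').symm⟩

theorem Equivalent.mem_sig {s t : WeakCreature A D} (h : P.Equivalent s t)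
    {l : List (WeakCreature A D)} (hs : s ∈ P.Sig l) : t ∈ P.Sig l := by
  refine sig_mono hs ?_
  have := h.2.2.2.2 [] []
  simp only [List.nil_append] at this
  rw [this]
  exact P.sig_self t h.2.1

/-! ## Omittory creating pairs -/

theorem FC.mdn_mono {w : List A} {t : ℕ → WeakCreature A D} {a b : ℕ} (h : P.FC w t a b)
    {i j : ℕ} (hi : a ≤ i) (hij : i ≤ j) (hj : j < b) :
    (t i).mdn ≤ (t j).mdn ∧ (t i).mup ≤ (t j).mup := by
  induction j, hij using Nat.le_induction with
  | base => exact ⟨le_rfl, le_rfl⟩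
  | succ j hij ih =>
    obtain ⟨h1, h2⟩ := ih (by omega)
    have e := h.2.2 j (hi.trans hij) hj
    have l1 := mdn_lt_mup (h.2.1 j (hi.trans hij) (by omega)).1
    have l2 := mdn_lt_mup (h.2.1 (j + 1) (by omega) hj).1
    omega

theorem FC.length_eq {w : List A} {t : ℕ → WeakCreature A D} {a b : ℕ} (h : P.FC w t a b) :
    w.length = (t a).mdn ∧ H.IsSeq w := by
  refine length_of_mem_basis ((h.2.1 a le_rfl h.1).2 ?_)
  rw [seg_self]; exact Pos.nil

theorem FC.length_pos {w u : List A} {t : ℕ → WeakCreature A D} {a b : ℕ} (h : P.FC w t a b)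
    (hu : u ∈ P.pos w (seg t a b)) : u.length = (t (b - 1)).mup := by
  have hab := h.1
  rw [Pos.length_eq hu (seg_ne_nil t hab)]
  obtain ⟨c, rfl⟩ := Nat.exists_eq_succ_of_ne_zero (Nat.ne_of_gt (Nat.zero_lt_of_lt hab))
  exact congrArg WeakCreature.mup (getLast_seg t (Nat.le_of_lt_succ hab))

theorem FC.restrict {w : List A} {t : ℕ → WeakCreature A D} {a b c : ℕ} (h : P.FC w t a b)
    (hac : a < c) (hcb : c ≤ b) : P.FC w t a c :=
  ⟨hac, fun i h1 h2 => h.2.1 i h1 (h2.trans_le hcb), fun i h1 h2 => h.2.2 i h1 (h2.trans_le hcb)⟩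

/-- The pieces of a possibility of a smooth creating pair are given by the single creatures. -/
theorem Smooth.mem_val (hs : P.Smooth) (hv : P.ValMonotone) {w u : List A}
    {t : ℕ → WeakCreature A D} {a b : ℕ} (h : P.FC w t a b) (hu : u ∈ P.pos w (seg t a b)) {i : ℕ}
    (hi : a ≤ i) (hib : i < b) : (u.take (t i).mdn, u.take (t i).mup) ∈ (t i).val := by
  have key : u.take (t i).mup ∈ P.pos w (seg t a (i + 1)) := by
    rcases (Nat.succ_le_of_lt hib).eq_or_lt with rfl | hlt
    · have hl := h.length_pos hu
      rw [Nat.succ_sub_one] at hl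
      rwa [← hl, List.take_length]
    · rw [h.2.2 i hi hlt]
      exact (hs w t a b h (i + 1) (by omega) hlt u hu).1
  have h2 := (hs w t a (i + 1) (h.restrict (by omega) hib) i hi (by omega) _ key).2
  rw [seg_succ, List.take_take, min_eq_left (mdn_lt_mup (h.2.1 i hi hib).1).le] at h2
  exact hv.mem_val h2

theorem Omittory.zeros_mem_pos {e : ℕ → ℕ → D → D} (ho : P.Omittory e) {w : List A}
    {t : ℕ → WeakCreature A D} {a b : ℕ} (h : P.FC w t a b) {i : ℕ} (hi : a ≤ i) (hib : i < b) :
    w ++ H.zeros (t a).mdn (t i).mdn ∈ P.pos w (seg t a i) := by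
  induction i, hi using Nat.le_induction with
  | base => simpa [seg_self, Alphabet.zeros] using mem_pos_nil.2 rfl
  | succ i hi ih =>
    have ih := ih (by omega)
    have h1 := h.2.1 i hi (by omega)
    have h2 := (ho.zero_pos _ h1.1 _ (h1.2 ih)).1
    rw [List.append_assoc, H.zeros_append (h.mdn_mono le_rfl hi (by omega)).1
      (mdn_lt_mup h1.1).le, h.2.2 i hi hib] at h2
    rw [seg_succ_right t hi]
    exact Pos.trans ih h2

/-- Stretch a creature of maximal norm over the whole interval: `⇛` preserves the norm. -/
theorem Omittory.growing {e : ℕ → ℕ → D → D} (ho : P.Omittory e) : P.Growing := by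
  intro t a b h
  obtain ⟨w, hw⟩ := id h
  obtain ⟨i, hi, hmax⟩ := (Finset.Ico a b).exists_max_image (fun i => (t i).nor)
    ⟨a, Finset.mem_Ico.2 ⟨le_rfl, hw.1⟩⟩
  rw [Finset.mem_Ico] at hi
  exact ⟨_, ho.extend_mem t a b h i hi.1 hi.2,
    fun j h1 h2 => hmax j (Finset.mem_Ico.2 ⟨h1, h2⟩)⟩

/-- The witness is `t_k` stretched over the interval. By `(⊕₃)` every successor of it is, up to
equivalence, a stretched `t'' ∈ Σ(t_k)`. Hence each possibility of `t''` after the zero prolongation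
of `w` becomes one of `t'` on appending zeros. -/
theorem Omittory.abZero {e : ℕ → ℕ → D → D} (ho : P.Omittory e) (hv : P.ValMonotone)
    (he : P.SigExtend e) : P.ABZero := by
  intro t a b hp k hak hkb
  have hs := ho.extend_mem t a b hp k hak hkb
  refine ⟨_, hs, minNor_le t hak hkb, fun w hw t' ht' hpos => ?_⟩
  have hk := hw.2.1 k hak hkb
  have hdn := (hw.mdn_mono le_rfl hak hkb).1
  have hup := (hw.mdn_mono hak (Nat.le_sub_one_of_lt hkb) (by omega)).2
  obtain ⟨t'', ht'', heq⟩ := (he (t k) hk.1 _ _ hdn hup (P.sig_subset _ hs)).1 t' ht'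
  obtain ⟨e1, e2⟩ := mdn_of_mem_sig ht''
  have hK := P.sig_subset _ ht''
  refine ⟨t'', ht'', hpos.trans_eq heq.2.2.1, _, ho.zeros_mem_pos hw hak hkb, fun u hu => ?_⟩
  have hval := hv.mem_val hu
  obtain ⟨l1, l2⟩ := length_of_mem_val hK hval
  obtain ⟨-, s2, s3, -⟩ := prefix_of_mem_val hK hval
  have hwu : w <+: u := (List.prefix_append _ _).trans s3
  refine ⟨u ++ H.zeros (t k).mup (t (b - 1)).mup, mem_pos_of_val heq.1 ?_, List.prefix_append _ _⟩
  rw [heq.2.2.2.1]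
  have hlen : (u ++ H.zeros (t k).mup (t (b - 1)).mup).length = (t (b - 1)).mup := by
    rw [List.length_append, H.length_zeros]; omega
  have hlt := mdn_lt_mup hK
  refine ⟨hw.length_eq.2, s2.append_zeros (by omega), hw.length_eq.1, hlen,
    hwu.trans (List.prefix_append _ _), ?_, ?_, ?_, ?_⟩
  · intro h
    have := congrArg List.length h
    have := hw.length_eq.1
    simp only at *
    omega
  · have h1 : (u ++ H.zeros (t k).mup (t (b - 1)).mup).take t''.mup = u := by
      rw [← l2, List.take_left]
    have h2 : (u ++ H.zeros (t k).mup (t (b - 1)).mup).take t''.mdn =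
        w ++ H.zeros (t a).mdn (t k).mdn := by
      rw [List.take_append_of_le_length (by omega), ← l1]
      exact (List.prefix_iff_eq_take.1 s3).symm
    simp only
    rw [h1, h2]
    exact hval
  · have := Alphabet.zeroOn_append_zeros (H := H) (b := (t k).mdn) hw.length_eq.1
    rw [e1]
    exact this.of_prefix (s3.trans (List.prefix_append _ _))
  · rw [e2]
    exact Alphabet.zeroOn_append_zeros (by omega)

/-! ## Sums -/

/-- Both `mdn` and `mup` are computed from `val`, so the value of a sum depends only on the values
of its terms. -/
theorem sumVal_congr_seq {U : Finset ℕ} {s s' : ℕ → WeakCreature A D} {a b : ℕ} (hab : a < b)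
    (h : ∀ i, a ≤ i → i < b → (s i).val = (s' i).val) :
    sumVal H U s a b = sumVal H U s' a b := by
  have hdn : ∀ i, a ≤ i → i < b → (s i).mdn = (s' i).mdn := fun i h1 h2 => by
    rw [WeakCreature.mdn, h i h1 h2, WeakCreature.mdn]
  have hup : ∀ i, a ≤ i → i < b → (s i).mup = (s' i).mup := fun i h1 h2 => by
    rw [WeakCreature.mup, h i h1 h2, WeakCreature.mup]
  have key : ∀ (s s' : ℕ → WeakCreature A D), (∀ i, a ≤ i → i < b → (s i).val = (s' i).val) →
      (∀ i, a ≤ i → i < b → (s i).mdn = (s' i).mdn) →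
      (∀ i, a ≤ i → i < b → (s i).mup = (s' i).mup) → sumVal H U s a b ⊆ sumVal H U s' a b := by
    rintro s s' h hdn hup x ⟨x1, x2, x3, x4, x5, x6, x7, x8, x9⟩
    refine ⟨x1, x2, x3.trans (hdn a le_rfl hab), x4.trans (hup _ (by omega) (by omega)), x5, x6,
      fun i h1 h2 h3 => ?_, fun i h1 h2 h3 => ?_, fun i h1 h2 => ?_⟩
    · rw [← h i h1 h2, ← hdn i h1 h2, ← hup i h1 h2]; exact x7 i h1 h2 h3
    · rw [← hdn i h1 h2, ← hup i h1 h2]; exact x8 i h1 h2 h3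
    · rw [← hup i h1 (by omega), ← hdn (i + 1) (by omega) h2]; exact x9 i h1 h2
  exact (key s s' h hdn hup).antisymm (key s' s (fun i h1 h2 => (h i h1 h2).symm)
    (fun i h1 h2 => (hdn i h1 h2).symm) fun i h1 h2 => (hup i h1 h2).symm)

/-- Also at an omitted index the sequence follows the creature, since continuing a possibility by
zeros is always allowed. Induction is needed because this applies only after the part before that
index is known to be a possibility. -/
theorem Omittory.mem_val_of_mem_sumVal {e : ℕ → ℕ → D → D} (ho : P.Omittory e)
    (hv : P.ValMonotone) {w x : List A} {U : Finset ℕ} {s : ℕ → WeakCreature A D} {a b : ℕ}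
    (h : P.FC w s a b) (hx : (w, x) ∈ sumVal H U s a b) {i : ℕ} (hi : a ≤ i) (hib : i < b) :
    (x.take (s i).mdn, x.take (s i).mup) ∈ (s i).val := by
  obtain ⟨-, -, x3, x4, x5, -, x7, x8, -⟩ := hx
  have step : ∀ i, a ≤ i → i < b → x.take (s i).mdn ∈ P.pos w (seg s a i) →
      (x.take (s i).mdn, x.take (s i).mup) ∈ (s i).val := by
    intro i h1 h2 hpos
    by_cases hiU : i ∈ U
    · exact x7 i h1 h2 hiU
    · have hK := h.2.1 i h1 h2
      have := hv.mem_val (ho.zero_pos _ hK.1 _ (hK.2 hpos)).1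
      simp only at x4
      have hup := (h.mdn_mono h1 (Nat.le_sub_one_of_lt h2) (by omega)).2
      have hlt := mdn_lt_mup hK.1
      rwa [← (x8 i h1 h2 hiU).take_eq hlt.le (by simp only; omega)] at this
  refine step i hi hib ?_
  induction i, hi using Nat.le_induction with
  | base =>
    have : x.take (s a).mdn = w := by
      simp only at x3
      rw [← x3]; exact (List.prefix_iff_eq_take.1 x5).symm
    rw [this, seg_self]
    exact Pos.nil
  | succ i hi ih =>
    have h1 := step i hi (by omega) (ih (by omega))
    rw [seg_succ_right s hi, ← h.2.2 i hi hib]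
    exact Pos.trans (ih (by omega)) (mem_pos_of_val (h.2.1 i hi (by omega)).1 h1)

theorem Omittory.sumVal_mono {e : ℕ → ℕ → D → D} (ho : P.Omittory e)
    (hv : P.ValMonotone) {w x : List A} {U U' : Finset ℕ} {s : ℕ → WeakCreature A D} {a b : ℕ}
    (h : P.FC w s a b) (hU : ∀ i, a ≤ i → i < b → i ∈ U → i ∈ U')
    (hx : (w, x) ∈ sumVal H U s a b) : (w, x) ∈ sumVal H U' s a b := by
  obtain ⟨x1, x2, x3, x4, x5, x6, x7, x8, x9⟩ := id hx
  exact ⟨x1, x2, x3, x4, x5, x6, fun i h1 h2 _ => ho.mem_val_of_mem_sumVal hv h hx h1 h2,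
    fun i h1 h2 h3 => x8 i h1 h2 fun h4 => h3 (hU i h1 h2 h4), x9⟩

/-- All creatures from `b` on are omitted, so prolonging the sum amounts to appending zeros.
Together with `Omittory.sumVal_mono` this makes `Reaches` monotone in both the set and the length.
-/
theorem sumVal_append_zeros {w x : List A} {U : Finset ℕ} {s : ℕ → WeakCreature A D} {a b c : ℕ}
    (h : P.FC w s a c) (hab : a < b) (hbc : b ≤ c) (hU : ∀ i ∈ U, i < b)
    (hx : (w, x) ∈ sumVal H U s a b) :
    (w, x ++ H.zeros (s (b - 1)).mup (s (c - 1)).mup) ∈ sumVal H U s a c := by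
  obtain ⟨x1, x2, x3, x4, x5, x6, x7, x8, x9⟩ := hx
  simp only at *
  have hup := (h.mdn_mono (i := b - 1) (j := c - 1) (by omega) (by omega) (by omega)).2
  have hpre : x <+: x ++ H.zeros (s (b - 1)).mup (s (c - 1)).mup := List.prefix_append _ _
  refine ⟨x1, x2.append_zeros x4, x3, ?_, x5.trans hpre, ?_, ?_, ?_, ?_⟩
  · simp only [List.length_append, H.length_zeros]; omega
  · intro he
    refine x6 (x5.eq_of_length ?_)
    have h1 := x5.length_le
    have h2 : w.length = _ := congrArg List.length he
    rw [List.length_append] at h2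
    omega
  · intro i h1 h2 h3
    have hib := hU i h3
    have l1 := (h.mdn_mono h1 (Nat.le_sub_one_of_lt hib) (by omega)).2
    have l2 := mdn_lt_mup (h.2.1 i h1 h2).1
    simp only
    rw [List.take_append_of_le_length (by omega), List.take_append_of_le_length (by omega)]
    exact x7 i h1 hib h3
  · intro i h1 h2 h3
    by_cases hib : i < b
    · exact (x8 i h1 hib h3).of_prefix hpre
    · have hz := Alphabet.zeroOn_append_zeros (H := H) (b := (s (c - 1)).mup) x4
      refine hz.mono ?_ (h.mdn_mono h1 (Nat.le_sub_one_of_lt h2) (by omega)).2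
      have e := h.2.2 (b - 1) (by omega) (by omega)
      rw [Nat.sub_add_cancel (by omega)] at e
      rw [e]
      exact (h.mdn_mono (by omega) (not_lt.1 hib) h2).1
  · intro i h1 h2 j h3 h4
    have := h.2.2 i h1 h2
    omega

theorem pos_refine_single {w : List A} {s t : ℕ → WeakCreature A D} {a b : ℕ}
    (hs : ∀ i, a ≤ i → i < b → s i ∈ P.Sig [t i]) :
    P.pos w (seg s a b) ⊆ P.pos w (seg t a b) := by
  intro u hu
  have h3 : P.Pos w (List.flatten ((seg t a b).map fun r => [r])) u := by
    refine Pos.refine hu _ ?_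
    rw [seg, seg, List.map_map, List.forall₂_map_left_iff, List.forall₂_map_right_iff,
      List.forall₂_same]
    intro j hj
    rw [List.mem_range'_1] at hj
    exact hs j hj.1 (by omega)
  rwa [← List.flatMap_def, List.flatMap_singleton'] at h3

theorem FC.refine_single (hn : P.Nice) {w : List A} {s t : ℕ → WeakCreature A D} {a b : ℕ}
    (h : P.FC w t a b) (hs : ∀ i, a ≤ i → i < b → s i ∈ P.Sig [t i]) : P.FC w s a b := by
  refine ⟨h.1, fun i h1 h2 => ⟨P.sig_subset _ (hs i h1 h2), fun u hu => ?_⟩, fun i h1 h2 => ?_⟩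
  · exact hn _ _ _ (hs i h1 h2) ((h.2.1 i h1 h2).2
      (pos_refine_single (fun j h3 h4 => hs j h3 (h4.trans h2)) hu))
  · rw [(mdn_of_mem_sig (hs i h1 (by omega))).2, h.2.2 i h1 h2,
      (mdn_of_mem_sig (hs (i + 1) (by omega) h2)).1]

/-! ## The second condition of the AB-type -/

/-- The pure candidates `t' ≥ t` whose norms are at least half of the norms of the creatures of `t`
from which they are built. -/
def HalfRefinement (P : CreatingPair H D) (t t' : ℕ → WeakCreature A D) : Prop :=
  P.PC t' ∧ P.PCLe t t' ∧
    ∀ i k l, t' i ∈ P.Sig (seg t k (k + l + 1)) → minNor t k (k + l + 1) / 2 ≤ (t' i).nor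

open Classical in
/-- The finite set `X ∩ n`. -/
noncomputable def initialPart (X : Set ℕ) (n : ℕ) : Finset ℕ := (Finset.range n).filter (· ∈ X)

theorem mem_initialPart {X : Set ℕ} {n i : ℕ} : i ∈ initialPart X n ↔ i < n ∧ i ∈ X := by
  simp [initialPart]

/-- Some possibility in the sum of `s_i`, `i ∈ X ∩ n`, from `w` extends a value of `z` at a
pure candidate whose norms are not too small. -/
def Reaches (P : CreatingPair H D) (t : ℕ → WeakCreature A D)
    (z : List A → (ℕ → WeakCreature A D) → List A) (w : List A) (X : Set ℕ) (n : ℕ)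
    (s : ℕ → WeakCreature A D) : Prop :=
  0 < n ∧ ∃ x, (w, x) ∈ sumVal H (initialPart X n) s 0 n ∧
    ∃ t', P.HalfRefinement t t' ∧ z w t' <+: x

section SecondCondition

variable {t : ℕ → WeakCreature A D} {z : List A → (ℕ → WeakCreature A D) → List A} {w : List A}

theorem Reaches.mono {e : ℕ → ℕ → D → D} (ho : P.Omittory e) (hv : P.ValMonotone) {X Y : Set ℕ}
    {m n : ℕ} {s : ℕ → WeakCreature A D} (h : P.Reaches t z w X m s) (hmn : m ≤ n)
    (hs : P.FC w s 0 n) (hXY : X ⊆ Y) : P.Reaches t z w Y n s := by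
  classical
  obtain ⟨hm, x, hx, t', ht', hz⟩ := h
  have h1 := sumVal_append_zeros hs hm hmn
    (fun i hi => (mem_initialPart.1 hi).1) hx
  refine ⟨hm.trans_le hmn, _, ho.sumVal_mono hv hs (fun i _ hi hiX => ?_) h1, t', ht',
    hz.trans (List.prefix_append _ _)⟩
  exact mem_initialPart.2 ⟨hi, hXY (mem_initialPart.1 hiX).2⟩

theorem Reaches.congr {X : Set ℕ} {n : ℕ} {s s' : ℕ → WeakCreature A D}
    (h : P.Reaches t z w X n s) (hs : ∀ i, i < n → (s i).val = (s' i).val) :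
    P.Reaches t z w X n s' := by
  obtain ⟨hn, x, hx, h⟩ := h
  exact ⟨hn, x, by rwa [← sumVal_congr_seq hn fun i _ hi => hs i hi], h⟩

theorem exists_block {k : ℕ → ℕ} (hk : StrictMono k) (h0 : k 0 = 0) (i : ℕ) :
    ∃ j, k j ≤ i ∧ i < k (j + 1) := by
  induction i with
  | zero => exact ⟨0, h0.le, h0.symm.trans_lt (hk Nat.zero_lt_one)⟩
  | succ i ih =>
    obtain ⟨j, h1, h2⟩ := ih
    rcases (Nat.succ_le_of_lt h2).eq_or_lt with h | h
    · exact ⟨j + 1, h.ge, h.trans_lt (hk j.succ.lt_succ_self)⟩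
    · exact ⟨j, h1.trans i.le_succ, h⟩

/-- Building a candidate from creatures `r_i ∈ Σ(t_i)`, where `i` runs over an infinite set. -/
theorem exists_pcle_extend {e : ℕ → ℕ → D → D} (ho : P.Omittory e)
    (he : P.SigExtend e) (hw : P.Candidate w t) {r : ℕ → WeakCreature A D}
    (hr : ∀ i, r i ∈ P.Sig [t i]) {j : ℕ → ℕ} (hj : StrictMono j) {k : ℕ → ℕ} (h0 : k 0 = 0)
    (hk : ∀ i, k (i + 1) = j i + 1) :
    StrictMono k ∧ (∀ i, k i ≤ j i) ∧ ∀ i,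
      (r (j i)).extend H e (t (k i)).mdn (t (j i)).mup ∈ P.Sig (seg t (k i) (k (i + 1))) := by
  have hkj : ∀ i, k i ≤ j i := by
    intro i
    cases i with
    | zero => rw [h0]; exact Nat.zero_le _
    | succ i => rw [hk]; exact hj i.lt_succ_self
  have hks : StrictMono k := strictMono_nat_of_lt_succ fun i => by
    rw [hk]; exact Nat.lt_succ_of_le (hkj i)
  refine ⟨hks, hkj, fun i => ?_⟩
  obtain ⟨v, hv⟩ := hw.pos_nonempty (k i)
  have hfc := hw.fc (hks i.lt_succ_self) hv
  have h1 := ho.extend_mem t _ _ ⟨v, hfc⟩ (j i) (hkj i) (by rw [hk]; exact Nat.lt_succ_self _)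
  have hlast : k (i + 1) - 1 = j i := by rw [hk]; rfl
  rw [hlast] at h1
  obtain ⟨q, hq, heq⟩ := (he (t (j i)) (hw _).1 _ _ (hw.linked.strictMono.monotone (hkj i)) le_rfl
    (P.sig_subset _ h1)).2 (r (j i)) (hr (j i))
  exact heq.mem_sig (sig_mono h1 hq)

/-- This is where halving pays off. The `s_i` may have tiny norms, but `X` selects creatures `r_i ∈
Σ(t_i)` of at least half the original norm whose values lie inside those of `s_i`. Stretched over
the gaps of `X` they form a half refinement, and the value of `z` there extends to a sequence lying
in the sum of the `s_i`. -/
theorem exists_reaches (hn : P.Nice) (hsm : P.Smooth) {e : ℕ → ℕ → D → D}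
    {half : WeakCreature A D → WeakCreature A D} (ho : P.Omittory e) (hh : P.WeakHalving half)
    (hv : P.ValMonotone) (he : P.SigExtend e) (hw : P.Candidate w t) (hnor : ∀ i, 2 < (t i).nor)
    (hz : ∀ t', P.PC t' → P.PCLe t t' → ∃ k, z w t' ∈ P.pos w (seg t' 0 k)) {X : Set ℕ}
    (hX : X.Infinite) {s : ℕ → WeakCreature A D} (hs : ∀ i, s i ∈ P.Sig [half (t i)])
    (hspos : ∀ i ∈ X, 0 < (s i).nor) : ∃ n, P.Reaches t z w X n s := by
  classical
  have hex : ∀ i, ∃ r ∈ P.Sig [t i], i ∈ X → (t i).nor / 2 ≤ r.nor ∧ r.val ⊆ (s i).val := by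
    intro i
    by_cases hi : i ∈ X
    · obtain ⟨r, hr, h1, h2⟩ := hh.2 _ (hw i).1 (hnor i).le (s i) (hs i) (hspos i hi)
      refine ⟨r, hr, fun _ => ⟨h1, ?_⟩⟩
      rintro ⟨x, y⟩ hxy
      exact hv.mem_val (h2 x ⟨r, hr, y, hxy⟩ (mem_pos_of_val (P.sig_subset _ hr) hxy))
    · exact ⟨t i, P.sig_self _ (hw i).1, fun h => absurd h hi⟩
  choose r hr hrX using hex
  let j := Nat.nth (· ∈ X)
  have hj : StrictMono j := Nat.nth_strictMono hX
  have hjX : ∀ i, j i ∈ X := fun i => Nat.nth_mem_of_infinite hX i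
  -- The `i`-th new creature covers the indices from `k i` through `j i`, where `j` enumerates `X`.
  -- It acts like `r (j i)` at its last index and is zero before that.
  let k : ℕ → ℕ := fun i => match i with
    | 0 => 0
    | i + 1 => j i + 1
  obtain ⟨hks, hkj, hmem⟩ := exists_pcle_extend ho he hw hr hj (k := k) rfl fun _ => rfl
  have hksucc : ∀ i, k (i + 1) = j i + 1 := fun _ => rfl
  set t' : ℕ → WeakCreature A D := fun i => (r (j i)).extend H e (t (k i)).mdn (t (j i)).mup
    with ht'
  have hle : P.PCLe t t' := ⟨k, hks, rfl, hmem⟩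
  have hcand : P.Candidate w t' := hw.pcle hn hle
  have hdn : ∀ i, (t' i).mdn = (t (k i)).mdn := fun i => (hw.linked.of_mem_sig (hmem i)).2.1
  have hup : ∀ i, (t' i).mup = (t (k (i + 1))).mdn := fun i => (hw.linked.of_mem_sig (hmem i)).2.2
  have hhalf : P.HalfRefinement t t' := by
    refine ⟨⟨w, hcand⟩, hle, fun i a l hi => ?_⟩
    obtain ⟨-, h1, h2⟩ := hw.linked.of_mem_sig hi
    have ha : a = k i := hw.linked.strictMono.injective (h1.symm.trans (hdn i))
    have hb : a + l + 1 = k (i + 1) := hw.linked.strictMono.injective (h2.symm.trans (hup i))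
    refine le_trans ?_ (hrX (j i) (hjX i)).1
    gcongr
    refine minNor_le t ?_ ?_
    · rw [ha]; exact hkj i
    · rw [hb, hksucc]; exact Nat.lt_succ_self _
  obtain ⟨m, hm⟩ := hz t' ⟨w, hcand⟩ hle
  -- One further creature guarantees that the segment is nonempty even if the value of `z` is `w`
  -- itself.
  obtain ⟨u, hu1, hu⟩ := hcand.mem_pos_succ hm
  have hfc : P.FC w t' 0 (m + 1) := hcand.fc m.succ_pos (mem_pos_nil.2 rfl)
  have hulen : u.length = (t (j m)).mup := (hcand.length_pos hu).trans <| by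
    rw [hdn, hksucc]; exact (hw (j m)).2.1.symm
  have hsdn : ∀ i, (s i).mdn = (t i).mdn := fun i =>
    (mdn_of_mem_sig (hs i)).1.trans (mdn_of_mem_sig (hh.1 _ (hw i).1).1).1
  have hsup : ∀ i, (s i).mup = (t i).mup := fun i =>
    (mdn_of_mem_sig (hs i)).2.trans (mdn_of_mem_sig (hh.1 _ (hw i).1).1).2
  have hblock : ∀ i, i < k (m + 1) → (i ∈ X → (u.take (t i).mdn, u.take (t i).mup) ∈ (s i).val) ∧
      (i ∉ X → H.ZeroOn u (t i).mdn (t i).mup) := by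
    intro i hi
    obtain ⟨a, ha1, ha2⟩ := exists_block hks rfl i
    have ham : a < m + 1 := hks.lt_iff_lt.1 (ha1.trans_lt hi)
    have hval := hsm.mem_val hv hfc hu (Nat.zero_le a) ham
    have hut : (t' a).mup = (t (j a)).mup := by
      rw [hup, hksucc]; exact (hw (j a)).2.1.symm
    rw [hut] at hval
    obtain ⟨-, -, -, -, -, -, h7, h8, -⟩ := hval
    simp only at h7 h8
    rw [(mdn_of_mem_sig (hr (j a))).1] at h7 h8
    rw [(mdn_of_mem_sig (hr (j a))).2, List.take_take, List.take_take, min_self,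
      min_eq_left (mdn_lt_mup (hw (j a)).1).le] at h7
    have hia : i ≤ j a := Nat.le_of_lt_succ ha2
    constructor
    · intro hiX
      -- The only element of `X` in the block ending at `j a` is `j a`, as `j` omits no element of
      -- `X`.
      have : i = j a := by
        refine hia.antisymm ?_
        by_contra! hlt
        have hc : Nat.count (· ∈ X) i < a := by
          rw [← hj.lt_iff_lt]
          rwa [show j (Nat.count (· ∈ X) i) = i from Nat.nth_count hiX]
        obtain ⟨b, rfl⟩ := Nat.exists_eq_succ_of_ne_zero (Nat.ne_of_gt (Nat.zero_lt_of_lt hc))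
        have h1 : j (Nat.count (· ∈ X) i) ≤ j b := hj.monotone (Nat.le_of_lt_succ hc)
        rw [show j (Nat.count (· ∈ X) i) = i from Nat.nth_count hiX] at h1
        have h2 : j b + 1 ≤ i := ha1
        omega
      subst this
      exact (hrX _ hiX).2 h7
    · intro hiX
      have hlt : i < j a := lt_of_le_of_ne hia fun h => hiX (h ▸ hjX a)
      refine (h8.of_prefix (List.take_prefix _ u)).mono (hw.linked.strictMono.monotone ha1) ?_
      rw [(hw i).2.1]
      exact hw.linked.strictMono.monotone hlt
  have hn0 : 0 < k (m + 1) := Nat.succ_pos _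
  refine ⟨k (m + 1), hn0, u, ⟨hw.length_eq.2, Pos.isSeq hu hw.length_eq.2, ?_, ?_, Pos.prefix hu,
    ?_, ?_, ?_, ?_⟩, t', hhalf, Pos.prefix hu1⟩
  · exact hw.length_eq.1.trans (hsdn 0).symm
  · exact hulen.trans (hsup (j m)).symm
  · intro h
    have h1 : w.length = u.length := congrArg List.length h
    rw [hw.length_eq.1, hulen] at h1
    have h2 := mdn_lt_mup (hw (j m)).1
    have h3 := hw.linked.strictMono.monotone (j m).zero_le
    change (t 0).mdn ≤ (t (j m)).mdn at h3
    omega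
  · intro i _ hi hiU
    simp only
    rw [hsdn, hsup]
    exact (hblock i hi).1 (mem_initialPart.1 hiU).2
  · intro i _ hi hiU
    rw [hsdn, hsup]
    exact (hblock i hi).2 fun h => hiU (mem_initialPart.2 ⟨hi, h⟩)
  · intro i _ _ a h1 h2
    have := (hw i).2.1
    rw [hsup] at h1
    rw [hsdn] at h2
    omega

/-- Compactness is applied to sequences of representatives of the sets `Σ(half(t_i))`, which are
finite modulo `∼`. Passing to representatives is harmless because only values and norms matter. -/
theorem exists_uniform_reaches (hn : P.Nice) (hsm : P.Smooth) (hf : P.StronglyFinitary)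
    {e : ℕ → ℕ → D → D} {half : WeakCreature A D → WeakCreature A D} (ho : P.Omittory e)
    (hh : P.WeakHalving half) (hv : P.ValMonotone) (he : P.SigExtend e) (hw : P.Candidate w t)
    (hnor : ∀ i, 2 < (t i).nor)
    (hz : ∀ t', P.PC t' → P.PCLe t t' → ∃ k, z w t' ∈ P.pos w (seg t' 0 k)) {X : Set ℕ}
    (hX : X.Infinite) : ∃ n, ∀ s : ℕ → WeakCreature A D, (∀ i, i < n → s i ∈ P.Sig [half (t i)]) →
      (∀ i ∈ X, i < n → 0 < (s i).nor) → P.Reaches t z w X n s := by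
  classical
  choose F hF1 hF2 hF3 using fun i => hf.2 [half (t i)]
  have : ∀ i, Finite (F i) := fun i => hF1 i
  have hhalf : ∀ i, half (t i) ∈ P.Sig [t i] := fun i => (hh.1 _ (hw i).1).1
  obtain ⟨n, hn⟩ := exists_uniform_bound (F := fun i => F i)
    (fun n s => (∀ i ∈ X, i < n → 0 < (s i).1.nor) → P.Reaches t z w X n fun i => (s i).1)
    (fun n s h hpos => (h fun i hi hin => hpos i hi (hin.trans n.lt_succ_self)).mono ho hv n.le_succ
      ((hw.fc n.succ_pos (mem_pos_nil.2 rfl)).refine_single hn fun i _ _ =>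
        sig_mono (hhalf i) (hF2 i (s i).2)) subset_rfl)
    (fun n s s' hss h hpos => by
      refine (h fun i hi hin => ?_).congr fun i hin => by rw [hss i hin]
      rw [hss i hin]; exact hpos i hi hin)
    (fun s => by
      by_cases hpos : ∀ i ∈ X, 0 < (s i).1.nor
      · obtain ⟨n, hn⟩ := exists_reaches hn hsm ho hh hv he hw hnor hz hX
          (s := fun i => (s i).1) (fun i => hF2 i (s i).2) hpos
        exact ⟨n, fun _ => hn⟩
      -- A choice with norm zero somewhere on `X` satisfies the implication vacuously once that
      -- index is included.
      · push Not at hpos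
        obtain ⟨i, hi, hle⟩ := hpos
        exact ⟨i + 1, fun h => absurd (h i hi i.lt_succ_self) (not_lt.2 hle)⟩)
  refine ⟨n, fun s hs hpos => ?_⟩
  have hrep : ∀ i, ∃ r ∈ F i, i < n → P.Equivalent (s i) r := by
    intro i
    by_cases hi : i < n
    · obtain ⟨r, hr, heq⟩ := hF3 i (s i) (hs i hi)
      exact ⟨r, hr, fun _ => heq⟩
    · obtain ⟨r, hr, -⟩ := hF3 i _ (P.sig_self _ (P.sig_subset _ (hhalf i)))
      exact ⟨r, hr, fun h => absurd h hi⟩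
  choose r hr heq using hrep
  refine (hn (fun i => ⟨r i, hr i⟩) fun i hi hin => ?_).congr fun i hin =>
    (heq i hin).2.2.2.1.symm
  exact (hpos i hi hin).trans_eq (heq i hin).2.2.1

/-- The second AB condition starting at index `0`, for finitely many roots at once. The pre-norm is
built from the monotone property "`R X n` for some positive `n`", so `N(u') > 0` already says that
positive-norm choices on `u'` catch a value of `z`. -/
theorem exists_sum_reaching (hn : P.Nice) (hsm : P.Smooth) (hf : P.StronglyFinitary)
    {e : ℕ → ℕ → D → D} {c : (Set ℕ → ℝ≥0) → Finset ℕ → ℕ → List D → D}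
    {half : WeakCreature A D → WeakCreature A D} (ho : P.Omittory e)
    (hh : P.WeakHalving half) (hsat : P.SaturatedNiceNat c) (hv : P.ValMonotone)
    (he : P.SigExtend e) {V : Set (List A)} (hV : V.Finite) (hVne : V.Nonempty)
    (hw : ∀ w ∈ V, P.Candidate w t) (hnor : ∀ i, 2 < (t i).nor)
    (hz : ∀ w ∈ V, ∀ t', P.PC t' → P.PCLe t t' → ∃ k, z w t' ∈ P.pos w (seg t' 0 k)) :
    ∃ n, 0 < n ∧ ∃ s ∈ P.Sig (seg t 0 n), minNor t 0 n / 2 ≤ s.nor ∧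
      ∀ w ∈ V, ∀ r ∈ P.Sig [s], 0 < r.nor →
        ∃ t', P.HalfRefinement t t' ∧ ∃ x ∈ P.pos w [r], z w t' <+: x := by
  classical
  obtain ⟨w₀, hw₀⟩ := hVne
  have hK : ∀ i, t i ∈ P.K := fun i => (hw w₀ hw₀ i).1
  have hhalf : ∀ i, half (t i) ∈ P.Sig [t i] := fun i => (hh.1 _ (hK i)).1
  have hFC : ∀ w ∈ V, ∀ n, 0 < n → P.FC w t 0 n := fun w hwV n h0 =>
    (hw w hwV).fc h0 (mem_pos_nil.2 rfl)
  let R : Set ℕ → ℕ → Prop := fun X n => ∀ w ∈ V, ∀ s : ℕ → WeakCreature A D,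
    (∀ i, i < n → s i ∈ P.Sig [half (t i)]) → (∀ i ∈ X, i < n → 0 < (s i).nor) →
      P.Reaches t z w X n s
  have hRmono : ∀ X Y m n, X ⊆ Y → m ≤ n → 0 < m → R X m → R Y n := by
    intro X Y m n hXY hmn hm h w hwV s hs hpos
    exact (h w hwV s (fun i hi => hs i (hi.trans_le hmn))
      fun i hi him => hpos i (hXY hi) (him.trans_le hmn)).mono ho hv hmn
      ((hFC w hwV n (hm.trans_le hmn)).refine_single hn fun i _ hi =>
        sig_mono (hhalf i) (hs i hi)) hXY
  -- With `N(u) > M > nor[t_0]`, the term `N(u)` does not lower the norm of the sum below half of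
  -- the minimum.
  obtain ⟨M, hM⟩ := exists_nat_gt (t 0).nor
  obtain ⟨N, hN, hNnat, hNpos, u, hu⟩ := exists_nicePreNorm (G := fun X => ∃ n, 0 < n ∧ R X n)
    (fun B C hBC ⟨n, h0, h⟩ => ⟨n, h0, hRmono B C n n hBC le_rfl h0 h⟩)
    (fun X hX => by
      have hex : ∀ w, ∃ n, w ∈ V → ∀ s : ℕ → WeakCreature A D,
          (∀ i, i < n → s i ∈ P.Sig [half (t i)]) → (∀ i ∈ X, i < n → 0 < (s i).nor) →
            P.Reaches t z w X n s := by
        intro w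
        by_cases hwV : w ∈ V
        · obtain ⟨n, h⟩ := exists_uniform_reaches hn hsm hf ho hh hv he (hw w hwV) hnor
            (hz w hwV) hX
          exact ⟨n, fun _ => h⟩
        · exact ⟨0, fun h => absurd h hwV⟩
      choose n hn' using hex
      -- For `n w = 0` the requirements on the sequence are void, and `Reaches` itself asserts that
      -- its length is positive.
      have h0 : ∀ w ∈ V, 0 < n w := by
        intro w hwV
        by_contra! hle
        exact absurd (hn' w hwV t (fun i hi => by omega) fun i _ hi => by omega).1 (not_lt.2 hle)
      let m := hV.toFinset.sup n
      have hm : ∀ w ∈ V, n w ≤ m := fun w hwV => Finset.le_sup (f := n) (hV.mem_toFinset.2 hwV)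
      refine ⟨m, m, (h0 w₀ hw₀).trans_le (hm w₀ hw₀), fun w hwV s hs hpos => ?_⟩
      have hfilter : initialPart (X ∩ Set.Iio m) m = initialPart X m := by
        ext i; simp +contextual [mem_initialPart]
      have := (hn' w hwV s (fun i hi => hs i (hi.trans_le (hm w hwV))) fun i hi him =>
        hpos i ⟨hi, him.trans_le (hm w hwV)⟩ (him.trans_le (hm w hwV))).mono ho hv (hm w hwV)
        ((hFC w hwV m ((h0 w hwV).trans_le (hm w hwV))).refine_single hn fun i _ hi =>
          sig_mono (hhalf i) (hs i hi)) subset_rfl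
      rwa [Reaches, hfilter]) M
  have hu0 : 0 < N u := lt_of_le_of_lt zero_le hu
  have hbound : ∀ u' : Finset ℕ, ∃ n, 0 < N u' → 0 < n ∧ R u' n := by
    intro u'
    by_cases h : 0 < N u'
    · obtain ⟨n, hn⟩ := (hNpos u' h).1
      exact ⟨n, fun _ => hn⟩
    · exact ⟨0, fun h' => absurd h' h⟩
  choose b hb using hbound
  -- The subset of `u` supplied by saturation is not known in advance, so `n` lies beyond the bounds
  -- of all subsets as well as beyond `u`.
  let n := u.powerset.sup b + u.sup id + 1
  have hn0 : 0 < n := Nat.succ_pos _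
  have hun : u ⊆ Finset.Ico 0 n := by
    intro i hi
    have : i ≤ u.sup id := Finset.le_sup (f := id) hi
    simp only [Finset.mem_Ico, n]; omega
  have hune : u.Nonempty := by simpa using (hNpos u hu0).2
  let τ : ℕ → WeakCreature A D := fun i => half (t i)
  have hτ : ∀ w ∈ V, P.FC w τ 0 n := fun w hwV =>
    (hFC w hwV n hn0).refine_single hn fun i _ _ => hhalf i
  have hτnor : ∀ i, (t i).nor / 2 ≤ (τ i).nor := fun i => (hh.1 _ (hK i)).2
  obtain ⟨hmem, hsub⟩ := hsat N hN hNnat u hune hu0 τ 0 n ⟨w₀, hτ w₀ hw₀⟩ hun fun i _ =>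
    lt_of_lt_of_le (half_pos (lt_trans two_pos (hnor i))) (hτnor i)
  refine ⟨n, hn0, dSum H c N u τ 0 n, ?_, ?_, fun w hwV r hr hrpos => ?_⟩
  · refine sig_refine (k := id) (s := τ) strictMono_id (fun i => ?_) (Nat.zero_le n) hmem
    rw [id, id, seg_succ]; exact hhalf i
  · refine le_min ?_ (le_csInf ?_ ?_)
    · calc minNor t 0 n / 2 ≤ minNor t 0 n := half_le_self zero_le
        _ ≤ (t 0).nor := minNor_le t le_rfl hn0
        _ ≤ N u := (hM.trans hu).le
    · exact hune.to_set.image _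
    · rintro _ ⟨i, hi, rfl⟩
      refine le_trans ?_ (hτnor i)
      gcongr
      exact minNor_le t (Nat.zero_le i) (Finset.mem_Ico.1 (hun hi)).2
  · obtain ⟨u', s, hu'ne, hu'pos, hu'u, hs, hval, hspos⟩ := hsub r hr hrpos
    obtain ⟨hb0, hbR⟩ := hb u' hu'pos
    have hbn : b u' ≤ n := by
      have : b u' ≤ u.powerset.sup b := Finset.le_sup (Finset.mem_powerset.2 hu'u)
      simp only [n]; omega
    obtain ⟨-, x, hx, t', ht', hzx⟩ := hRmono u' u' _ n subset_rfl hbn hb0 hbR w hwV s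
      (fun i hi => hs i i.zero_le hi) fun i hi _ => hspos i hi
    have hfilter : initialPart (u' : Set ℕ) n = u' := by
      ext i
      rw [mem_initialPart, Finset.mem_coe]
      exact ⟨fun h => h.2, fun h => ⟨(Finset.mem_Ico.1 (hun (hu'u h))).2, h⟩⟩
    rw [hfilter] at hx
    exact ⟨t', ht', x, mem_pos_of_val (P.sig_subset _ hr) (hval hx), hzx⟩

theorem abOne_of_saturated (hn : P.Nice) (hsm : P.Smooth) (hf : P.StronglyFinitary)
    {e : ℕ → ℕ → D → D} {c : (Set ℕ → ℝ≥0) → Finset ℕ → ℕ → List D → D}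
    {half : WeakCreature A D → WeakCreature A D} (ho : P.Omittory e)
    (hh : P.WeakHalving half) (hsat : P.SaturatedNiceNat c) (hv : P.ValMonotone)
    (he : P.SigExtend e) : P.ABOne := by
  intro w t hw N₀ hnor z hz
  have hmin : ∀ a b, minNor (fun i => t (N₀ + i)) a b = minNor t (N₀ + a) (N₀ + b) := by
    intro a b
    rw [minNor, minNor, ← Set.image_const_add_Ico, Set.image_image]
  obtain ⟨n, hn0, s, hs, hsn, h⟩ := exists_sum_reaching hn hsm hf ho hh hsat hv he
    (t := fun i => t (N₀ + i)) (z := z) (hf.1.finite_pos hw N₀) (hw.pos_nonempty N₀)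
    (fun v hvw => hw.tail hn hvw) (fun i => hnor _ (Nat.le_add_right _ _))
    (fun v hvw t' h1 h2 => (hz.2 v hvw t' h1 h2).imp fun _ h => h.1)
  rw [seg_shift, add_zero] at hs
  rw [hmin, add_zero] at hsn
  refine ⟨N₀ + n, by omega, s, hs, hsn, fun v hvw r hr hrpos => ?_⟩
  obtain ⟨t', ⟨h1, h2, h3⟩, x, hx, hzx⟩ := h v hvw r hr hrpos
  refine ⟨t', h1, h2, fun i k l hi => ?_, x, hx, hzx⟩
  have := h3 i k l
  rw [seg_shift, hmin, add_assoc, ← add_assoc N₀, ← add_assoc (N₀ + k)] at this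
  exact this hi

end SecondCondition

/-! ## The order of the forcing notion -/

/-- For linked sequences this is the requirement on the norms in the definition of the forcing
notion. -/
def Normed (t : ℕ → WeakCreature A D) : Prop := ∀ i, ((t i).mdn : ℝ≥0) < (t i).nor

theorem QStarSInf.normed (p : P.QStarSInf) : Normed p.t := fun i =>
  lt_of_le_of_lt (by exact_mod_cast le_max_right _ _) (p.norm i)

/-- The condition given by a normed candidate. -/
def Candidate.condition {w : List A} {t : ℕ → WeakCreature A D} (h : P.Candidate w t)
    (ht : Normed t) : P.QStarSInf where
  w := w
  t := t
  candidate := h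
  norm i := by rw [max_eq_right (h.linked.le_mdn i)]; exact ht i

theorem QStarSInf.ext_of {p q : P.QStarSInf} (hw : p.w = q.w) (ht : p.t = q.t) : p = q := by
  cases p; cases q; cases hw; cases ht; rfl

theorem PCLe.tail {s t : ℕ → WeakCreature A D} {k : ℕ → ℕ} (hk : StrictMono k)
    (hs : ∀ i, s i ∈ P.Sig (seg t (k i) (k (i + 1)))) (c : ℕ) :
    P.PCLe (fun i => t (k c + i)) fun i => s (c + i) := by
  have hle : ∀ i, k c ≤ k (c + i) := fun i => hk.monotone (Nat.le_add_right c i)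
  refine ⟨fun i => k (c + i) - k c, strictMono_nat_of_lt_succ fun i => ?_, by simp, fun i => ?_⟩
  · have h1 := hle i
    have h2 : k (c + i) < k (c + (i + 1)) := hk (by omega)
    omega
  · rw [seg_shift, Nat.add_sub_cancel' (hle i), Nat.add_sub_cancel' (hle (i + 1))]
    exact hs (c + i)

theorem QStarSInf.le_iff {p q : P.QStarSInf} :
    p ≤ q ↔ ∃ n, q.w ∈ P.pos p.w (seg p.t 0 n) ∧ P.PCLe (fun i => p.t (n + i)) q.t := by
  constructor
  · rintro ⟨k, hk, hw, hs⟩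
    refine ⟨k 0, hw, ?_⟩
    simpa using PCLe.tail hk hs 0
  · rintro ⟨n, hw, k, hk, h0, hs⟩
    refine ⟨fun i => n + k i, hk.const_add n, ?_, fun i => ?_⟩
    · simpa [h0] using hw
    · rw [← seg_shift]; exact hs i

theorem QStarSInf.le_of_pcle {p q : P.QStarSInf} (hw : q.w = p.w) (h : P.PCLe p.t q.t) :
    p ≤ q :=
  QStarSInf.le_iff.2 ⟨0, by rw [seg_self, hw]; exact Pos.nil, by simpa using h⟩

theorem Normed.shift {t : ℕ → WeakCreature A D} (h : Normed t) (n : ℕ) :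
    Normed fun i => t (n + i) := fun i => h (n + i)

theorem Normed.pos {t : ℕ → WeakCreature A D} (h : Normed t) (i : ℕ) : 0 < (t i).nor :=
  lt_of_le_of_lt zero_le (h i)

theorem Normed.mdn_lt_minNor {t : ℕ → WeakCreature A D} (h : Normed t) (ht : P.Linked t)
    {a b : ℕ} (hab : a < b) : ((t a).mdn : ℝ≥0) < minNor t a b := by
  obtain ⟨i, h1, -, h3⟩ := minNor_attained t hab
  rw [h3]
  refine lt_of_le_of_lt ?_ (h i)
  exact_mod_cast ht.strictMono.monotone h1

/-- The lengths of possibilities are the numbers `m_dn(t_i)`. Hence `u` is the restriction of `x` at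
which smoothness cuts. -/
theorem Smooth.mem_pos_of_prefix (hs : P.Smooth) {w u x : List A} {t : ℕ → WeakCreature A D}
    (hw : P.Candidate w t) {k n : ℕ} (hu : u ∈ P.pos w (seg t 0 k))
    (hx : x ∈ P.pos w (seg t 0 n)) (hux : u <+: x) : k ≤ n ∧ x ∈ P.pos u (seg t k n) := by
  have h1 := hw.length_pos hu
  have h2 := hw.length_pos hx
  have hkn : k ≤ n := hw.linked.strictMono.le_iff_le.1 (by
    rw [← h1, ← h2]; exact hux.length_le)
  refine ⟨hkn, ?_⟩
  rcases hkn.eq_or_lt with rfl | hlt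
  · rw [seg_self, hux.eq_of_length (h1.trans h2.symm)]; exact Pos.nil
  · have := (hs w t 0 n (hw.fc (Nat.zero_lt_of_lt hlt) (mem_pos_nil.2 rfl)) k k.zero_le hlt x hx).2
    rwa [← h1, ← List.prefix_iff_eq_take.1 hux] at this

/-! ## Deciding values of a name -/

/-- `(v, S)` is a condition which puts into the name `τ` a pair `(m, j)` with `j < b`. -/
def DecidesBelow (τ : BaireName P.QStarSInf) (m b : ℕ) (v : List A) (S : ℕ → WeakCreature A D) :
    Prop :=
  ∃ q : P.QStarSInf, q.w = v ∧ q.t = S ∧ ∃ j < b, ∃ r, τ.mem m j r ∧ r ≤ q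

/-- `(v, S)` is a condition which decides the value of `τ` at `m`. -/
def Decides (τ : BaireName P.QStarSInf) (m : ℕ) (v : List A) (S : ℕ → WeakCreature A D) : Prop :=
  ∃ b, P.DecidesBelow τ m b v S

variable {τ : BaireName P.QStarSInf}

theorem DecidesBelow.mono {m b : ℕ} {v : List A} {S : ℕ → WeakCreature A D}
    (h : P.DecidesBelow τ m b v S) {n : ℕ} {q : P.QStarSInf} (hw : q.w ∈ P.pos v (seg S 0 n))
    (ht : P.PCLe (fun i => S (n + i)) q.t) : P.DecidesBelow τ m b q.w q.t := by
  obtain ⟨p, rfl, rfl, j, hj, r, hr, hrp⟩ := h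
  exact ⟨q, rfl, rfl, j, hj, r, hr, hrp.trans (QStarSInf.le_iff.2 ⟨n, hw, ht⟩)⟩

theorem DecidesBelow.mono_bound {m b b' : ℕ} {v : List A} {S : ℕ → WeakCreature A D}
    (h : P.DecidesBelow τ m b v S) (hb : b ≤ b') : P.DecidesBelow τ m b' v S := by
  obtain ⟨p, h1, h2, j, hj, h3⟩ := h
  exact ⟨p, h1, h2, j, hj.trans_le hb, h3⟩

theorem Decides.pure_mono (hn : P.Nice) {m : ℕ} {v : List A} {S S' : ℕ → WeakCreature A D}
    (h : P.Decides τ m v S) (hS : P.PCLe S S') (hS' : Normed S') : P.Decides τ m v S' := by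
  obtain ⟨b, hb⟩ := h
  have hc : P.Candidate v S := by
    obtain ⟨p, rfl, rfl, -⟩ := hb
    exact p.candidate
  exact ⟨b, hb.mono (n := 0) (q := (hc.pcle hn hS).condition hS')
    (by rw [seg_self]; exact Pos.nil) (by simp only [zero_add]; exact hS)⟩

/-- If some pure extension of `(v, S)` decides the value of `τ` at `m`, then so does `(v, S)`. -/
def PureDecision (τ : BaireName P.QStarSInf) (S : ℕ → WeakCreature A D) (v : List A) (m : ℕ) :
    Prop :=
  ∀ S', P.PCLe S S' → P.Decides τ m v S' → P.Decides τ m v S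

theorem PureDecision.mono (hn : P.Nice) {S S' : ℕ → WeakCreature A D} {v : List A} {m : ℕ}
    (h : P.PureDecision τ S v m) (hS : P.PCLe S S') (hS' : Normed S') :
    P.PureDecision τ S' v m := fun R hR hd =>
  (h R (hS.trans hR) hd).pure_mono hn hS hS'

/-- The pairs are handled one after another: pass to a deciding pure extension if there is one,
otherwise change nothing. Pure decision survives normed pure extensions, so earlier pairs are not
spoiled. -/
theorem exists_pureDecision_of_finite (hn : P.Nice) {S : ℕ → WeakCreature A D} (hS : P.Linked S)
    (hSn : Normed S) {E : Set (List A × ℕ)} (hE : E.Finite) :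
    ∃ S', P.PCLe S S' ∧ Normed S' ∧ ∀ x ∈ E, P.PureDecision τ S' x.1 x.2 := by
  induction E, hE using Set.Finite.induction_on with
  | empty => exact ⟨S, PCLe.refl fun i => (hS i).1, hSn, fun x hx => hx.elim⟩
  | @insert x E _ _ ih =>
    obtain ⟨S', h1, h2, h3⟩ := ih
    by_cases hex : ∃ R, P.PCLe S' R ∧ P.Decides τ x.2 x.1 R
    · obtain ⟨R, hR, hd⟩ := hex
      have hRn : Normed R := by
        obtain ⟨_, q, -, rfl, -⟩ := hd
        exact q.normed
      refine ⟨R, h1.trans hR, hRn, ?_⟩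
      rintro y (rfl | hy)
      · exact fun _ _ _ => hd
      · exact (h3 y hy).mono hn hR hRn
    · refine ⟨S', h1, h2, ?_⟩
      rintro y (rfl | hy)
      · exact fun R hR hd => absurd ⟨R, hR, hd⟩ hex
      · exact h3 y hy

/-- A root of a condition with sequence `S'` has length `m_dn(S'_0) = m_dn(S_0)`. Finitely many
sequences have this length, and for all other `v` nothing is ever decided. -/
theorem exists_pureDecision (hn : P.Nice) (hf : P.Finitary) (τ : BaireName P.QStarSInf)
    {S : ℕ → WeakCreature A D} (hS : P.Linked S) (hSn : Normed S) :
    ∃ S', P.PCLe S S' ∧ Normed S' ∧ ∀ v, ∀ m ≤ (S' 0).mdn, P.PureDecision τ S' v m := by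
  obtain ⟨S', h1, h2, h3⟩ := exists_pureDecision_of_finite (τ := τ) hn hS hSn
    ((H.finite_isSeq hf.1 (S 0).mdn).prod (Set.finite_Iic (S 0).mdn))
  refine ⟨S', h1, h2, fun v m hm R hR hd => ?_⟩
  refine h3 (v, m) ⟨?_, ?_⟩ R hR hd
  · obtain ⟨_, q, rfl, rfl, -⟩ := hd
    exact ⟨q.candidate.length_eq.2, q.candidate.length_eq.1.trans <|
      (hR.mdn_zero (h1.linked hS)).trans (h1.mdn_zero hS)⟩
  · rw [Set.mem_Iic, ← h1.mdn_zero hS]; exact hm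

/-- Fusion: a pure extension all of whose tails have the pure decision property. -/
theorem exists_fusion (hn : P.Nice) (hf : P.Finitary) (τ : BaireName P.QStarSInf)
    {S : ℕ → WeakCreature A D} (hS : P.Linked S) (hSn : Normed S) :
    ∃ t, P.PCLe S t ∧ Normed t ∧
      ∀ n v, ∀ m ≤ (t n).mdn, P.PureDecision τ (fun i => t (n + i)) v m := by
  choose f hf1 hf2 hf3 using fun S : {S : ℕ → WeakCreature A D // P.Linked S ∧ Normed S} =>
    exists_pureDecision hn hf τ S.2.1 S.2.2
  have hfl : ∀ S, P.Linked (f S) := fun S => (hf1 S).linked S.2.1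
  -- Each stage refines, retains its first creature for good, and hands on the rest. The limit is
  -- the sequence of retained creatures, and each of its tails is a pure extension of the
  -- corresponding stage.
  let next : {S : ℕ → WeakCreature A D // P.Linked S ∧ Normed S} →
      {S : ℕ → WeakCreature A D // P.Linked S ∧ Normed S} := fun S =>
    ⟨fun i => f S (1 + i), (hfl S).shift 1, (hf2 S).shift 1⟩
  let X : ℕ → {S : ℕ → WeakCreature A D // P.Linked S ∧ Normed S} := fun n =>
    next^[n] ⟨S, hS, hSn⟩
  have hX : ∀ n, X (n + 1) = next (X n) := fun n => Function.iterate_succ_apply' _ _ _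
  let t : ℕ → WeakCreature A D := fun n => f (X n) 0
  have hlinked : P.Linked t := fun n => by
    refine ⟨(hfl (X n) 0).1, (hfl (X n) 0).2.trans ?_⟩
    have := (hf1 (X (n + 1))).mdn_zero (X (n + 1)).2.1
    refine Eq.trans ?_ this.symm
    rw [hX]
  have hpiece : ∀ n i, ∃ d, P.PCLe (fun j => f (X n) (d + j)) (f (X (n + i))) := by
    intro n i
    induction i with
    | zero =>
      refine ⟨0, ?_⟩
      simpa using PCLe.refl fun j => (hfl (X n) j).1
    | succ i ih =>
      obtain ⟨d, k, hk, h0, hs⟩ := ih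
      refine ⟨d + k 1, PCLe.trans (s := (X (n + i + 1)).1) ?_ (hf1 (X (n + i + 1)))⟩
      rw [hX]
      have := PCLe.tail hk hs 1
      simpa only [← add_assoc] using this
  have htail : ∀ n, P.PCLe (f (X n)) fun i => t (n + i) := by
    intro n
    refine PCLe.of_pieces (hfl _) (hlinked.shift n) rfl fun i => ?_
    obtain ⟨d, k, hk, h0, hs⟩ := hpiece n i
    exact ⟨_, _, by simpa only [seg_shift] using hs 0⟩
  have htn : Normed t := fun n => hf2 (X n) 0
  refine ⟨t, ?_, htn, fun n v m hm => (hf3 (X n) v m hm).mono hn (htail n) (htn.shift n)⟩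
  have := (hf1 (X 0)).trans (htail 0)
  simp only [zero_add] at this
  exact this

/-! ## Decision functions -/

theorem pos_congr_equivalent {w : List A} {s t : ℕ → WeakCreature A D} {a b : ℕ}
    (h : ∀ i, a ≤ i → i < b → P.Equivalent (s i) (t i)) :
    P.pos w (seg s a b) = P.pos w (seg t a b) :=
  (pos_refine_single fun i h1 h2 => (h i h1 h2).symm.mem_sig (P.sig_self _ (h i h1 h2).2.1)).antisymm
    (pos_refine_single fun i h1 h2 => (h i h1 h2).mem_sig (P.sig_self _ (h i h1 h2).1))

/-- The possibilities from `v` along `j` creatures of `t'` which satisfy `R`, or all of them if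
one of these creatures is bad. -/
def stops (P : CreatingPair H D) (R : List A → Prop) (bad : WeakCreature A D → Prop) (v : List A)
    (t' : ℕ → WeakCreature A D) (j : ℕ) : Set (List A) :=
  {u | u ∈ P.pos v (seg t' 0 j) ∧ (R u ∨ ∃ i < j, bad (t' i))}

/-- Stop at the least stage where an admissible possibility exists. The `bad` clause makes `z`
total: a candidate with a bad creature may stop anywhere past it, and nothing is claimed about its
value. -/
theorem exists_decisionFunction {w : List A} {t : ℕ → WeakCreature A D}
    {N₀ : ℕ} {R : List A → Prop} {bad : WeakCreature A D → Prop}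
    (hbad : ∀ s s', P.Equivalent s s' → bad s → bad s')
    (hex : ∀ v ∈ P.pos w (seg t 0 N₀), ∀ t', P.PC t' → P.PCLe (fun i => t (N₀ + i)) t' →
      ∃ j, (P.stops R bad v t' j).Nonempty) :
    ∃ z, P.IsDecisionFunction w t N₀ z ∧ ∀ v ∈ P.pos w (seg t 0 N₀), ∀ t', P.PC t' →
      P.PCLe (fun i => t (N₀ + i)) t' → (∀ i, ¬ bad (t' i)) → R (z v t') := by
  classical
  -- The choice depends only on the set. Candidates that are equivalent up to the stopping stage
  -- have the same stop sets, so they get the same value. For a sequence not above the tail of `t`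
  -- the value is just `v`.
  let pick : Set (List A) → List A := fun W => if h : W.Nonempty then h.some else []
  have hpick : ∀ W : Set (List A), W.Nonempty → pick W ∈ W := fun W h => by
    simp only [pick, dif_pos h]; exact h.some_mem
  let J : List A → (ℕ → WeakCreature A D) → ℕ := fun v t' =>
    sInf {j | (P.stops R bad v t' j).Nonempty}
  let z : List A → (ℕ → WeakCreature A D) → List A := fun v t' =>
    if P.PCLe (fun i => t (N₀ + i)) t' then pick (P.stops R bad v t' (J v t')) else v
  have hz : ∀ v ∈ P.pos w (seg t 0 N₀), ∀ t', P.PC t' → P.PCLe (fun i => t (N₀ + i)) t' →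
      z v t' ∈ P.stops R bad v t' (J v t') := by
    intro v hv t' h1 h2
    simp only [z, if_pos h2]
    exact hpick _ (Nat.sInf_mem (hex v hv t' h1 h2))
  have hcongr : ∀ v t' t'' k, (∀ i, i < k → P.Equivalent (t'' i) (t' i)) → ∀ j ≤ k,
      P.stops R bad v t'' j = P.stops R bad v t' j := by
    intro v t' t'' k h j hj
    ext u
    simp only [stops, Set.mem_ofPred_eq]
    rw [pos_congr_equivalent fun i _ hi => h i (hi.trans_le hj)]
    refine and_congr_right fun _ => or_congr_right ⟨?_, ?_⟩
    · rintro ⟨i, hi, hb⟩; exact ⟨i, hi, hbad _ _ (h i (hi.trans_le hj)) hb⟩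
    · rintro ⟨i, hi, hb⟩; exact ⟨i, hi, hbad _ _ (h i (hi.trans_le hj)).symm hb⟩
  refine ⟨z, ⟨fun v hv t' h1 => ?_, fun v hv t' h1 h2 => ?_⟩, fun v hv t' h1 h2 h3 => ?_⟩
  · by_cases h2 : P.PCLe (fun i => t (N₀ + i)) t'
    · have h := (hz v hv t' h1 h2).1
      obtain ⟨k, hk, h0, hs⟩ := h2
      have h' := pos_refine hk hs (Nat.zero_le _) h
      rw [seg_shift, h0] at h'
      exact ⟨_, Nat.le_add_right _ _, pos_append (Nat.zero_le _) (Nat.le_add_right _ _) hv h'⟩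
    · refine ⟨N₀, le_rfl, ?_⟩
      simp only [z, if_neg h2]
      exact hv
  · refine ⟨J v t', (hz v hv t' h1 h2).1, fun t'' h1' h2' heq => ?_⟩
    have hst := hcongr v t' t'' _ heq
    have hJ' : (P.stops R bad v t' (J v t')).Nonempty := Nat.sInf_mem (hex v hv t' h1 h2)
    have hJ'' : (P.stops R bad v t'' (J v t'')).Nonempty := Nat.sInf_mem (hex v hv t'' h1' h2')
    have hle : J v t'' ≤ J v t' := Nat.sInf_le (by
      change (P.stops R bad v t'' (J v t')).Nonempty
      rwa [hst _ le_rfl])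
    have hge : J v t' ≤ J v t'' := Nat.sInf_le (by
      change (P.stops R bad v t' (J v t'')).Nonempty
      rwa [← hst _ hle])
    simp only [z, if_pos h2, if_pos h2']
    rw [hle.antisymm hge, hst _ le_rfl]
  · rcases (hz v hv t' h1 h2).2 with h | ⟨i, -, hi⟩
    · exact h
    · exact absurd hi (h3 i)

/-- `t` is a sequence for a condition with root `w` whose tails have the pure decision property. -/
structure Fused (P : CreatingPair H D) (τ : BaireName P.QStarSInf) (w : List A)
    (t : ℕ → WeakCreature A D) : Prop where
  candidate : P.Candidate w t
  normed : Normed t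
  pure : ∀ n v, ∀ m ≤ (t n).mdn, P.PureDecision τ (fun i => t (n + i)) v m

variable {w : List A} {t : ℕ → WeakCreature A D}

/-- The halved norms of `t'` may be too small for a condition, but growing lets blocks of `t'` be
merged into creatures of sufficient norm. Some extension of the merged condition decides `τ(m)`. It
is also a pure extension of a tail of `t` with the new root, so by pure decision that tail decides
as well. -/
theorem Fused.exists_decides (hn : P.Nice) (hg : P.Growing) (h : P.Fused τ w t) {m : ℕ}
    {v : List A} (hv : v ∈ P.pos w (seg t 0 m)) {t' : ℕ → WeakCreature A D}
    (ht' : P.PCLe (fun i => t (m + i)) t')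
    (hhalf : ∀ i k l, t' i ∈ P.Sig (seg t (m + k) (m + k + l + 1)) →
      minNor t (m + k) (m + k + l + 1) / 2 ≤ (t' i).nor) :
    ∃ j, ∃ u ∈ P.pos v (seg t' 0 j), ∃ n, u ∈ P.pos w (seg t 0 n) ∧
      P.Decides τ m u fun i => t (n + i) := by
  have hvt := h.candidate.tail hn hv
  have hc := hvt.pcle hn ht'
  have hnor : ∀ i, ((t' i).mdn : ℝ≥0) / 2 ≤ (t' i).nor := by
    intro i
    obtain ⟨k, hk, h0, hs⟩ := id ht'
    obtain ⟨l, hl⟩ := Nat.exists_eq_add_of_lt (hk i.lt_succ_self)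
    have hi := hs i
    have hmdn := (hvt.linked.of_mem_sig hi).2.1
    rw [seg_shift, ← Nat.succ_eq_add_one, hl, ← add_assoc, ← add_assoc] at hi
    refine le_trans ?_ (hhalf i _ _ hi)
    gcongr
    rw [hmdn]
    exact (h.normed.mdn_lt_minNor h.candidate.linked (by omega)).le
  -- The last creature of the block has index, hence `m_dn`, at least `2 * (t' a).mdn + 2`. Half of
  -- this exceeds the `m_dn` of the block.
  let step : ℕ → ℕ := fun a => a + 2 * (t' a).mdn + 3
  let L : ℕ → ℕ := fun n => step^[n] 0
  have hL : ∀ n, L (n + 1) = L n + 2 * (t' (L n)).mdn + 3 := fun n =>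
    Function.iterate_succ_apply' _ _ _
  have hLs : StrictMono L := strictMono_nat_of_lt_succ fun n => by rw [hL]; omega
  have hex : ∀ n, ∃ s ∈ P.Sig (seg t' (L n) (L (n + 1))), ((t' (L n)).mdn : ℝ≥0) < s.nor := by
    intro n
    obtain ⟨x, hx⟩ := hc.pos_nonempty (L n)
    obtain ⟨s, hs, hsn⟩ := hg t' _ _ ⟨x, hc.fc (hLs n.lt_succ_self) hx⟩
    refine ⟨s, hs, ?_⟩
    have h1 := hsn (L n + 2 * (t' (L n)).mdn + 2) (by omega) (by rw [hL]; omega)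
    refine lt_of_lt_of_le ?_ ((hnor _).trans h1)
    rw [lt_div_iff₀ two_pos]
    have h2 := hc.linked.le_mdn (L n + 2 * (t' (L n)).mdn + 2)
    exact_mod_cast (by omega)
  choose s hs hsn using hex
  have hsle : P.PCLe t' s := ⟨L, hLs, rfl, hs⟩
  have hsnormed : Normed s := fun n => by
    rw [(hc.linked.of_mem_sig (hs n)).2.1]; exact hsn n
  let q₀ := (hc.pcle hn hsle).condition hsnormed
  obtain ⟨q, hq, j, r, hr, hrq⟩ := τ.total m q₀
  have hp₀ : h.candidate.condition h.normed ≤ q₀ :=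
    QStarSInf.le_iff.2 ⟨m, hv, ht'.trans hsle⟩
  have hp : h.candidate.condition h.normed ≤ q := hp₀.trans hq
  obtain ⟨a, ha, -⟩ := QStarSInf.le_iff.1 hq
  obtain ⟨n, hqn, hqt⟩ := QStarSInf.le_iff.1 hp
  refine ⟨L a, q.w, pos_refine hLs hs a.zero_le ha, n, hqn, ?_⟩
  refine h.pure n q.w m ?_ q.t hqt ⟨j + 1, q, rfl, rfl, j, j.lt_succ_self, r, hr, hrq⟩
  calc m ≤ (t m).mdn := h.candidate.linked.le_mdn m
    _ = v.length := (h.candidate.length_pos hv).symm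
    _ ≤ q.w.length := (Pos.prefix ha).length_le
    _ = (t n).mdn := h.candidate.length_pos hqn

/-- By smoothness `q` passes through `u`, and hence extends the condition consisting of `u` and the
tail of `t`. This transfers the decision to `q`. -/
theorem Fused.decidesBelow_of_prefix (hs : P.Smooth) (h : P.Fused τ w t) {m b k : ℕ} {u : List A}
    (hu : u ∈ P.pos w (seg t 0 k)) (hd : P.DecidesBelow τ m b u fun i => t (k + i))
    {q : P.QStarSInf} (hq : h.candidate.condition h.normed ≤ q) (huq : u <+: q.w) :
    P.DecidesBelow τ m b q.w q.t := by
  obtain ⟨n, hqn, hqt⟩ := QStarSInf.le_iff.1 hq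
  obtain ⟨hkn, hpos⟩ := hs.mem_pos_of_prefix h.candidate hu hqn huq
  obtain ⟨d, rfl⟩ := Nat.exists_eq_add_of_le hkn
  refine hd.mono (n := d) ?_ ?_
  · rw [seg_shift]; exact hpos
  · simp only [← add_assoc]; exact hqt

theorem Fused.exists_block (hn : P.Nice) (hs : P.Smooth) (hf : P.Finitary) (hg : P.Growing)
    (hab : P.ABOne) (h : P.Fused τ w t) {m : ℕ} (hm : 2 ≤ m) :
    ∃ n b, m < n ∧ ∃ s ∈ P.Sig (seg t m n), minNor t m n / 2 ≤ s.nor ∧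
      ∀ v ∈ P.pos w (seg t 0 m), ∀ r ∈ P.Sig [s], 0 < r.nor →
        ∃ x ∈ P.pos v [r], P.DecidesBelow τ m b x fun i => t (n + i) := by
  let R : List A → Prop := fun u => ∃ n, u ∈ P.pos w (seg t 0 n) ∧
    P.Decides τ m u fun i => t (n + i)
  -- The bad creatures are those violating clause (α). Candidates supplied by the AB-type contain
  -- none, and candidates without them do reach a decision.
  let bad : WeakCreature A D → Prop := fun s => ∃ k l,
    s ∈ P.Sig (seg t (m + k) (m + k + l + 1)) ∧ s.nor < minNor t (m + k) (m + k + l + 1) / 2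
  obtain ⟨z, hz, hzR⟩ := exists_decisionFunction (P := P) (w := w) (t := t) (N₀ := m) (R := R)
    (bad := bad)
    (fun s s' heq => by
      rintro ⟨k, l, h1, h2⟩
      exact ⟨k, l, heq.mem_sig h1, heq.2.2.1 ▸ h2⟩)
    (fun v hv t' _ h2 => by
      by_cases hb : ∃ i, bad (t' i)
      · obtain ⟨i, hi⟩ := hb
        obtain ⟨u, hu⟩ := ((h.candidate.tail hn hv).pcle hn h2).pos_nonempty (i + 1)
        exact ⟨i + 1, u, hu, Or.inr ⟨i, i.lt_succ_self, hi⟩⟩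
      · push Not at hb
        obtain ⟨j, u, hu, hR⟩ := h.exists_decides hn hg hv h2 fun i k l hi =>
          not_lt.1 fun hlt => hb i ⟨k, l, hi, hlt⟩
        exact ⟨j, u, hu, Or.inl hR⟩)
  have hnor : ∀ i, m ≤ i → 2 < (t i).nor := by
    intro i hi
    refine lt_of_le_of_lt ?_ (h.normed i)
    exact_mod_cast (hm.trans hi).trans (h.candidate.linked.le_mdn i)
  obtain ⟨n, hmn, s, hsS, hsn, hdec⟩ := hab w t h.candidate m hnor z hz
  have hex : ∀ v ∈ P.pos w (seg t 0 m), ∀ r ∈ P.Sig [s], 0 < r.nor →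
      ∃ x ∈ P.pos v [r], P.Decides τ m x fun i => t (n + i) := by
    intro v hv r hr hr0
    obtain ⟨t', h1, h2, h3, x, hx, hzx⟩ := hdec v hv r hr hr0
    obtain ⟨k, hk, b, hkd⟩ := hzR v hv t' h1 h2 fun i ⟨k, l, hi, hlt⟩ =>
      absurd (h3 i k l hi) (not_le.2 hlt)
    have hxn : x ∈ P.pos w (seg t 0 n) :=
      pos_append m.zero_le hmn.le hv (mem_pos_one (sig_mono hsS hr) hx)
    refine ⟨x, hx, b, ?_⟩
    exact h.decidesBelow_of_prefix hs hk hkd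
      (q := (h.candidate.tail hn hxn).condition (h.normed.shift n))
      (QStarSInf.le_iff.2 ⟨n, hxn, PCLe.refl fun i => (h.candidate (n + i)).1⟩) hzx
  have hbd : ∀ x, ∃ b, P.Decides τ m x (fun i => t (n + i)) →
      P.DecidesBelow τ m b x fun i => t (n + i) := by
    intro x
    by_cases hd : P.Decides τ m x fun i => t (n + i)
    · exact hd.imp fun b hb _ => hb
    · exact ⟨0, fun h => absurd h hd⟩
  choose b hb using hbd
  refine ⟨n, (hf.finite_pos h.candidate n).toFinset.sup b, hmn, s, hsS, hsn,
    fun v hv r hr hr0 => ?_⟩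
  obtain ⟨x, hx, hd⟩ := hex v hv r hr hr0
  refine ⟨x, hx, (hb x hd).mono_bound (Finset.le_sup ?_)⟩
  rw [Set.Finite.mem_toFinset]
  exact pos_append m.zero_le hmn.le hv (mem_pos_one (sig_mono hsS hr) hx)

/-- Prolonging a creature to the left by means of the first condition of the AB-type. -/
theorem Fused.exists_prolongation (hn : P.Nice) (hab : P.ABZero)
    (h : P.Fused τ w t) {a m n b : ℕ} (hm : a + 2 * (t a).mdn ≤ m) (hmn : m < n)
    {s : WeakCreature A D} (hsS : s ∈ P.Sig (seg t m n)) (hsn : minNor t m n / 2 ≤ s.nor)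
    (hdec : ∀ v ∈ P.pos w (seg t 0 m), ∀ r ∈ P.Sig [s], 0 < r.nor →
      ∃ x ∈ P.pos v [r], P.DecidesBelow τ m b x fun i => t (n + i)) :
    ∃ T ∈ P.Sig (seg t a n), ((t a).mdn : ℝ≥0) < T.nor ∧
      ∀ v ∈ P.pos w (seg t 0 a), ∀ r ∈ P.Sig [T], 0 < r.nor →
        ∃ x ∈ P.pos v [r], P.DecidesBelow τ m b x fun i => t (n + i) := by
  have ham : a ≤ m := by omega
  -- The segment `t_a, …, t_{m-1}, s` is written as a sequence, so that the first AB condition can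
  -- be applied with distinguished place `m`.
  let σ : ℕ → WeakCreature A D := fun i => if i < m then t i else s
  have hσ : ∀ i, i < m → σ i = t i := fun i hi => if_pos hi
  have hσm : σ m = s := if_neg (lt_irrefl m)
  have hseg : ∀ c i, i ≤ m → seg σ c i = seg t c i := fun c i hi =>
    seg_congr fun j _ hj => hσ j (hj.trans_le hi)
  have hmdn := (h.candidate.linked.of_mem_sig hsS).2.1
  have hfc : ∀ v ∈ P.pos w (seg t 0 a), P.FC v σ a (m + 1) := by
    intro v hv
    refine ⟨by omega, fun i hi him => ?_, fun i hi him => ?_⟩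
    · rw [hseg a i (by omega)]
      have hsub : P.pos v (seg t a i) ⊆ P.basis (t i) := fun u hu =>
        (h.candidate i).2.2 (pos_append a.zero_le hi hv hu)
      rcases (Nat.le_of_lt_succ him).eq_or_lt with rfl | hlt
      · rw [hσm]
        exact ⟨P.sig_subset _ hsS, hsub.trans (hn.basis_seg hsS hmn)⟩
      · rw [hσ i hlt]
        exact ⟨(h.candidate i).1, hsub⟩
    · rw [hσ i (by omega), (h.candidate i).2.1]
      rcases (Nat.le_of_lt_succ him).eq_or_lt with he | hlt
      · rw [he, hσm, hmdn]
      · rw [hσ _ hlt]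
  obtain ⟨v₀, hv₀⟩ := h.candidate.pos_nonempty a
  obtain ⟨T, hT, hTn, hTd⟩ := hab σ a (m + 1) ⟨v₀, hfc v₀ hv₀⟩ m ham m.lt_succ_self
  have hTS : T ∈ P.Sig (seg t a n) := by
    rw [seg_succ_right σ ham, hσm, hseg a m le_rfl] at hT
    have hL : List.Forall₂ (fun s S => s ∈ P.Sig S) (seg t a m ++ [s])
        ((seg t a m).map (fun r => [r]) ++ [seg t m n]) := by
      refine List.rel_append ?_ (by simpa using hsS)
      rw [seg, List.map_map, List.forall₂_map_left_iff, List.forall₂_map_right_iff,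
        List.forall₂_same]
      exact fun i _ => P.sig_self _ (h.candidate i).1
    have := P.sig_trans _ _ hL hT
    rw [List.flatten_append, List.flatten_singleton, ← List.flatMap_def,
      List.flatMap_singleton', seg_append t ham hmn.le] at this
    exact this
  refine ⟨T, hTS, lt_of_lt_of_le ?_ hTn, fun v hv r hr hr0 => ?_⟩
  · obtain ⟨i, hai, him, hi⟩ := minNor_attained σ (show a < m + 1 by omega)
    rw [hi]
    rcases (Nat.le_of_lt_succ him).eq_or_lt with rfl | hlt
    -- Here `nor[s]` is at least half of a minimum exceeding `m_dn(t_m) ≥ m ≥ 2 * (t a).mdn`.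
    · rw [hσm]
      refine lt_of_lt_of_le ?_ hsn
      rw [lt_div_iff₀ two_pos]
      refine lt_of_le_of_lt ?_ (h.normed.mdn_lt_minNor h.candidate.linked hmn)
      have := h.candidate.linked.le_mdn i
      exact_mod_cast (by omega)
    · rw [hσ i hlt]
      refine lt_of_le_of_lt ?_ (h.normed i)
      exact_mod_cast h.candidate.linked.strictMono.monotone hai
  · obtain ⟨t'', ht'', ht0, u, hu, hux⟩ := hTd v (hfc v hv) r hr hr0
    rw [hσm] at ht''
    rw [hseg a m le_rfl] at hu
    have huw := pos_append a.zero_le ham hv hu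
    obtain ⟨y, hy, hyd⟩ := hdec u huw t'' ht'' ht0
    obtain ⟨x, hx, hyx⟩ := hux y hy
    have hxw := pos_append a.zero_le (ham.trans hmn.le) hv (mem_pos_one (sig_mono hTS hr) hx)
    have hyw := pos_append m.zero_le hmn.le huw (mem_pos_one (sig_mono hsS ht'') hy)
    have hxy : y = x := hyx.eq_of_length
      ((h.candidate.length_pos hyw).trans (h.candidate.length_pos hxw).symm)
    exact ⟨x, hx, hxy ▸ hyd⟩

/-! ## Almost bounding -/

/-- The bound `g` depends on the fused sequence alone. Only the positions at which blocks are
inserted depend on `B`. -/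
theorem almostBounding_of_abType (hn : P.Nice) (hs : P.Smooth) (hf : P.Finitary) (hg : P.Growing)
    (hc : P.Condensed) (hab : P.ABType) : AlmostBounding P.QStarSInf := by
  intro τ p
  obtain ⟨t, hpt, htn, htp⟩ := exists_fusion hn hf τ p.candidate.linked p.normed
  have h : P.Fused τ p.w t := ⟨p.candidate.pcle hn hpt, htn, htp⟩
  let p' := h.candidate.condition h.normed
  have hpp' : p ≤ p' := QStarSInf.le_of_pcle rfl hpt
  have hblock : ∀ m, ∃ n b, 2 ≤ m → m < n ∧ ∃ s ∈ P.Sig (seg t m n), minNor t m n / 2 ≤ s.nor ∧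
      ∀ v ∈ P.pos p.w (seg t 0 m), ∀ r ∈ P.Sig [s], 0 < r.nor →
        ∃ x ∈ P.pos v [r], P.DecidesBelow τ m b x fun i => t (n + i) := by
    intro m
    by_cases hm : 2 ≤ m
    · obtain ⟨n, b, hnb⟩ := h.exists_block hn hs hf hg hab.2 hm
      exact ⟨n, b, fun _ => hnb⟩
    · exact ⟨0, 0, fun h => absurd h hm⟩
  choose N g hN using hblock
  refine ⟨g, fun B hB => ?_⟩
  have hnext : ∀ a, ∃ m ∈ B, a ≤ m ∧ a < N m ∧ ∃ T ∈ P.Sig (seg t a (N m)),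
      ((t a).mdn : ℝ≥0) < T.nor ∧ ∀ v ∈ P.pos p.w (seg t 0 a), ∀ r ∈ P.Sig [T], 0 < r.nor →
        ∃ x ∈ P.pos v [r], P.DecidesBelow τ m (g m) x fun i => t (N m + i) := by
    intro a
    -- The summand `2 * (t a).mdn` pays for the norm of the prolongation, and `2` ensures `m ≥ 2`,
    -- so that the norms from `m` on exceed `2`.
    obtain ⟨m, hmB, hm⟩ := hB.exists_gt (a + 2 * (t a).mdn + 2)
    obtain ⟨h1, s, h2, h3, h4⟩ := hN m (by omega)
    exact ⟨m, hmB, by omega, by omega,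
      h.exists_prolongation hn hab.1 (by omega) h1 h2 h3 h4⟩
  choose M hMB hMa hMN Tc hTc hTn hTd using hnext
  let a : ℕ → ℕ := fun i => (fun c => N (M c))^[i] 0
  have ha : ∀ i, a (i + 1) = N (M (a i)) := fun i => Function.iterate_succ_apply' _ _ _
  have has : StrictMono a := strictMono_nat_of_lt_succ fun i => by rw [ha]; exact hMN _
  let T : ℕ → WeakCreature A D := fun i => Tc (a i)
  have hT : ∀ i, T i ∈ P.Sig (seg t (a i) (a (i + 1))) := fun i => by rw [ha]; exact hTc _
  have htT : P.PCLe t T := ⟨a, has, rfl, hT⟩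
  have hTnormed : Normed T := fun i => by
    rw [(h.candidate.linked.of_mem_sig (hT i)).2.1]; exact hTn _
  have hTcand : P.Candidate p.w T := h.candidate.pcle hn htT
  let q := hTcand.condition hTnormed
  have hp'q : p' ≤ q := QStarSInf.le_of_pcle rfl htT
  refine ⟨q, hpp'.trans hp'q, fun m₀ q' hqq' => ?_⟩
  obtain ⟨k, hk, hkw, hkt⟩ := id hqq'
  -- Working with the creature of `q'` at place `m₀ + 1` guarantees that the block found has index
  -- `i > m₀`, and so that the decided argument `M (a i) ≥ a i ≥ i` exceeds `m₀`.
  obtain ⟨u, hu⟩ := q'.candidate.pos_nonempty (m₀ + 1)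
  have huT : u ∈ P.pos p.w (seg T 0 (k (m₀ + 1))) :=
    pos_append (Nat.zero_le _) (hk.monotone (Nat.zero_le _)) hkw
      (pos_refine hk hkt (Nat.zero_le _) hu)
  obtain ⟨i, hki, hik, s, hsT, v, hv, hs0, hsu⟩ := hc u T _ _
    (hTcand.fc (hk (m₀ + 1).lt_succ_self) huT) (fun i _ _ => hTnormed.pos i) _ (hkt (m₀ + 1))
    (q'.normed.pos _)
  have hvt : v ∈ P.pos p.w (seg t 0 (a i)) :=
    pos_refine has hT i.zero_le (pos_append (Nat.zero_le _) hki huT hv)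
  obtain ⟨x, hx, hxd⟩ := hTd (a i) v hvt s hsT hs0
  obtain ⟨u', hu', hxu'⟩ := hsu x hx
  have hu'q : u' ∈ P.pos q'.w (seg q'.t 0 (m₀ + 1 + 1)) := by
    rw [seg_succ_right _ (Nat.zero_le _)]
    exact Pos.trans hu hu'
  let q'' := (q'.candidate.tail hn hu'q).condition (q'.normed.shift _)
  have hq'q'' : q' ≤ q'' :=
    QStarSInf.le_iff.2 ⟨_, hu'q, PCLe.refl fun i => (q'.candidate _).1⟩
  have hxt : x ∈ P.pos p.w (seg t 0 (N (M (a i)))) := by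
    refine pos_append (Nat.zero_le _) (hMN _).le hvt (mem_pos_one (sig_mono (hTc _) hsT) hx)
  obtain ⟨q₁, h1, h2, j, hj, r, hr, hrq⟩ := h.decidesBelow_of_prefix hs hxt hxd
    (hp'q.trans (hqq'.trans hq'q'')) hxu'
  have hq₁ : q₁ = q'' := QStarSInf.ext_of h1 h2
  refine ⟨q'', hq'q'', M (a i), hMB _, ?_, j, hj, r, hr, hq₁ ▸ hrq⟩
  have h3 := hMa (a i)
  have h4 := has.le_apply (x := i)
  have h5 := hk.le_apply (x := m₀ + 1)
  omega

end CreatingPair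

end Creatures

/-! ### Assembly of the two parts -/

theorem mainTheorem12 {A : Type*} {D : Type*} (H : Creatures.Alphabet A)
    (P : Creatures.CreatingPair H D) (hnice : P.Nice) (hsmooth : P.Smooth) :
    (P.Finitary → P.Growing → P.Condensed → P.ABType →
      Creatures.AlmostBounding P.QStarSInf) ∧
    (∀ (e : ℕ → ℕ → D → D) (c : (Set ℕ → NNReal) → Finset ℕ → ℕ → List D → D)
      (half : Creatures.WeakCreature A D → Creatures.WeakCreature A D),
      P.StronglyFinitary → P.Omittory e → P.WeakHalving half → P.SaturatedNiceNat c →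
      P.ValMonotone → P.HalfExtend e half → P.SigExtend e →
      P.ABType ∧ (P.Condensed → Creatures.AlmostBounding P.QStarSInf)) := by
  refine ⟨fun hf hg hc hab =>
    Creatures.CreatingPair.almostBounding_of_abType hnice hsmooth hf hg hc hab,
    fun e c half hf ho hh hsat hv _ he => ?_⟩
  have hab : P.ABType := ⟨ho.abZero hv he,
    Creatures.CreatingPair.abOne_of_saturated hnice hsmooth hf ho hh hsat hv he⟩
  exact ⟨hab, fun hc =>
    Creatures.CreatingPair.almostBounding_of_abType hnice hsmooth hf.1 ho.growing hc hab⟩
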